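/- Let $P$ be a smooth finite-dimensional real manifold without boundary, let $\hat T$ be a finite-dimensional real vector space, and let $L\subset TP$ be a smooth involutive distribution, i.e. a smooth vector subbundle of $TP$ such that the Lie bracket of any two smooth local sections of $L$ is again a local section of $L$. Let $k$ and $r$ be integers with $1\le r\le k$, and let $\omega\in\Omega^k(P,\hat T)$ be a smooth closed $k$-form on $P$ with values in $\hat T$. Suppose that $\omega$ is $(k-r)$-horizontal with respect to $L$, i.e. that for every $p\in P$ and all $v_1,\dots,v_{r+1}\in L_p$, $$ \mathrm i_{v_1}\cdots\,\mathrm i_{v_{r+1}}\,\omega_p=0 , $$ where $\mathrm i_v$ denotes contraction with $v$ (and the contraction of a $0$-form is zero). Then for every point of $P$ there exist an open neighborhood $U$ of that point and a smooth $(k-1)$-form $\theta\in\Omega^{k-1}(U,\hat T)$ which is also $(k-r)$-horizontal with respect to $L$, i.e. such that for every $p\in U$ and all $v_1,\dots,v_r\in L_p$, $$ \mathrm i_{v_1}\cdots\,\mathrm i_{v_r}\,\theta_p=0 , $$ and such that $\omega=d\theta$ on $U$. -/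

import Mathlib

open Set
open scoped Manifold ContDiff Topology

noncomputable section

namespace PoincareHorizontal

/-- All `m`-fold contractions `i_{v₁} ⋯ i_{vₘ} α` of the alternating form `α` with vectors
`v₁, …, vₘ` of the subspace `V` vanish. The contraction `i_v α` is `α.curryLeft v`, that is,
`α(v, ·, …, ·)`; the contraction of a `0`-form is zero. -/
def ContractionsVanish {W T : Type*} [AddCommGroup W] [Module ℝ W] [AddCommGroup T] [Module ℝ T]
    (V : Submodule ℝ W) : (m k : ℕ) → (W [⋀^Fin k]→ₗ[ℝ] T) → Prop
  | 0, _, α => α = 0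
  | _ + 1, 0, _ => True
  | m + 1, k + 1, α => ∀ v ∈ V, ContractionsVanish V m k (α.curryLeft v)

section Manifold

variable {E : Type*} [NormedAddCommGroup E] [NormedSpace ℝ E]
  {P : Type*} [TopologicalSpace P] [ChartedSpace E P]
  {T : Type*} [NormedAddCommGroup T] [NormedSpace ℝ T]

variable (E P T) in
/-- A (not necessarily continuous) differential `k`-form on the manifold `P`, modelled on `E`,
with values in the vector space `T`. -/
abbrev DiffForm (k : ℕ) : Type _ :=
  (p : P) → TangentSpace 𝓘(ℝ, E) p [⋀^Fin k]→L[ℝ] T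

/-- The expression of a form in the preferred chart at `x₀`, i.e. its pullback under the inverse
of this chart. It is meaningful on the target of the chart, an open subset of `E`. -/
def DiffForm.inChart {k : ℕ} (η : DiffForm E P T k) (x₀ : P) : E → E [⋀^Fin k]→L[ℝ] T :=
  fun y => (η ((extChartAt 𝓘(ℝ, E) x₀).symm y)).compContinuousLinearMap
    (mfderiv 𝓘(ℝ, E) 𝓘(ℝ, E) (extChartAt 𝓘(ℝ, E) x₀).symm y)

/-- The form `η` is smooth on the open set `U`: its expressions in charts are smooth. -/
def DiffForm.SmoothOn {k : ℕ} (η : DiffForm E P T k) (U : Set P) : Prop :=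
  ∀ x₀ : P, ContDiffOn ℝ ∞ (η.inChart x₀)
    ((extChartAt 𝓘(ℝ, E) x₀).target ∩ (extChartAt 𝓘(ℝ, E) x₀).symm ⁻¹' U)

/-- The exterior derivative: at `p`, take the exterior derivative of the expression of the form
in the chart at `p`, and pull it back to the manifold under this chart. -/
def DiffForm.d {k : ℕ} (η : DiffForm E P T k) : DiffForm E P T (k + 1) :=
  fun p => (extDeriv (η.inChart p) (extChartAt 𝓘(ℝ, E) p p)).compContinuousLinearMap
    (mfderiv 𝓘(ℝ, E) 𝓘(ℝ, E) (extChartAt 𝓘(ℝ, E) p) p)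

variable [IsManifold 𝓘(ℝ, E) ∞ P]

/-- The vector field `X` is smooth on the set `U`. -/
def SmoothFieldOn (X : (p : P) → TangentSpace 𝓘(ℝ, E) p) (U : Set P) : Prop :=
  ContMDiffOn 𝓘(ℝ, E) 𝓘(ℝ, E).tangent ∞ (fun p => (⟨p, X p⟩ : TangentBundle 𝓘(ℝ, E) P)) U

/-- The family `L` of subspaces of the tangent spaces is a smooth distribution, i.e. a smooth
vector subbundle of the tangent bundle: around each point it has a smooth local frame. -/
def IsDistribution (L : (p : P) → Submodule ℝ (TangentSpace 𝓘(ℝ, E) p)) : Prop :=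
  ∀ p : P, ∃ U : Set P, IsOpen U ∧ p ∈ U ∧
    ∃ (d : ℕ) (X : Fin d → (q : P) → TangentSpace 𝓘(ℝ, E) q),
      (∀ i, SmoothFieldOn (X i) U) ∧
      ∀ q ∈ U, LinearIndependent ℝ (fun i => X i q) ∧
        Submodule.span ℝ (range fun i => X i q) = L q

/-- The distribution `L` is involutive: the Lie bracket of two smooth local sections of `L` is
again a local section of `L`. -/
def IsInvolutive (L : (p : P) → Submodule ℝ (TangentSpace 𝓘(ℝ, E) p)) : Prop :=
  ∀ (U : Set P) (X Y : (p : P) → TangentSpace 𝓘(ℝ, E) p), IsOpen U →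
    SmoothFieldOn X U → SmoothFieldOn Y U → (∀ p ∈ U, X p ∈ L p) → (∀ p ∈ U, Y p ∈ L p) →
    ∀ p ∈ U, VectorField.mlieBracket 𝓘(ℝ, E) X Y p ∈ L p

end Manifold

end PoincareHorizontal

end

noncomputable section

namespace PoincareHorizontal

/-! ### Contractions -/

/-! The claim is local, so a chart moves it to an open subset of `E` on which `L` has a frame. There
the distribution is made constant (Frobenius), and a homotopy operator adapted to it is applied.

Straightening. Let `F y` be the projection onto `L y` along a fixed complement, `R = F y₀`, `Q = 1 -
R`. The bracket of the fields `F · a` and `F · b` lies in `L` by involutivity; it is killed by `R`,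
because `R (F y a) = R a` does not depend on `y`. As `R` is injective on `L y`, the fields commute
(`fderiv_projection_symm`). Let `Φ x` be the value at time one of the solution of `u' = F u x`, `u 0
= y₀ + Q x`. Commutation gives `DΦ(x) w = F (Φ x) w` for `w` in the range of `R`, so `Φ` carries
this constant distribution to `L` (`exists_straightening`). Smoothness of `Φ` follows from the
inverse function theorem in `C(I, E)`, applied to the integral equation; this needs the smoothness
of superposition operators (`contDiff_postcomp`).

Constant distribution (`exists_primitive_of_linear`). The homotopy `Q + t R` moves points along the
leaves. Its operator `K` contracts with `R x`, which is tangent to the leaves: vanishing on `r + 1`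
such vectors becomes vanishing on `r`. For closed `η` one has `dKη = η - Q^*η`. The closed form
`Q^*η` is already killed by one vector of the range of `R`, and so is its primitive under the radial
homotopy; since `1 ≤ r`, this suffices. -/

theorem contractionsVanish_iff {W T : Type*} [AddCommGroup W] [Module ℝ W] [AddCommGroup T]
    [Module ℝ T] (V : Submodule ℝ W) (m k : ℕ) (α : W [⋀^Fin k]→ₗ[ℝ] T) :
    ContractionsVanish V m k α ↔
      (m ≤ k → ∀ w : Fin k → W, (∀ i : Fin k, (i : ℕ) < m → w i ∈ V) → α w = 0) := by
  induction m generalizing k with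
  | zero => simp [ContractionsVanish, AlternatingMap.ext_iff]
  | succ m ih =>
    cases k with
    -- A `0`-form is contracted here: both sides hold vacuously, the right one through the guard `m
    -- ≤ k`.
    | zero => simp [ContractionsVanish]
    | succ k =>
      simp only [ContractionsVanish, ih, AlternatingMap.curryLeft_apply_apply,
        add_le_add_iff_right]
      constructor
      · intro h hm w hw
        have := h (w 0) (hw 0 (by simp)) hm (Fin.tail w) fun i hi => hw i.succ (by simpa using hi)
        rwa [← Fin.cons_self_tail w]
      · intro h v hv hm w hw
        refine h hm _ fun i hi => ?_
        cases i using Fin.cases with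
        | zero => simpa using hv
        | succ i => simpa using hw i (by simpa using hi)

section Alternating

variable {E F T : Type*} [NormedAddCommGroup E] [NormedSpace ℝ E]
  [NormedAddCommGroup F] [NormedSpace ℝ F] [NormedAddCommGroup T] [NormedSpace ℝ T]

theorem ContractionsVanish.comp {V : Submodule ℝ F} {V' : Submodule ℝ E} {m k : ℕ}
    {α : F [⋀^Fin k]→L[ℝ] T} (h : ContractionsVanish V m k α.toAlternatingMap) (g : E →L[ℝ] F)
    (hg : ∀ v ∈ V', g v ∈ V) :
    ContractionsVanish V' m k (α.compContinuousLinearMap g).toAlternatingMap := by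
  rw [contractionsVanish_iff] at h ⊢
  exact fun hm w hw => h hm (g ∘ w) fun i hi => hg _ (hw i hi)

variable [FiniteDimensional ℝ E] [FiniteDimensional ℝ T]

instance finiteDimensional_continuousMultilinearMap (k : ℕ) :
    FiniteDimensional ℝ (ContinuousMultilinearMap ℝ (fun _ : Fin k => E) T) :=
  FiniteDimensional.of_injective
    ({ toFun := fun f => f.toMultilinearMap
       map_add' := fun _ _ => rfl
       map_smul' := fun _ _ => rfl } :
      ContinuousMultilinearMap ℝ (fun _ : Fin k => E) T →ₗ[ℝ] MultilinearMap ℝ (fun _ => E) T)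
    ContinuousMultilinearMap.toMultilinearMap_injective

/-- Composition is smooth for multilinear maps. In finite dimension the inclusion of alternating
maps into multilinear ones has a continuous linear left inverse, which brings the result back. -/
theorem contDiff_compContinuousLinearMap (k : ℕ) :
    ContDiff ℝ ∞ fun p : (F [⋀^Fin k]→L[ℝ] T) × (E →L[ℝ] F) =>
      p.1.compContinuousLinearMap p.2 := by
  obtain ⟨l, hl⟩ := LinearMap.exists_leftInverse_of_injective
    (ContinuousAlternatingMap.toContinuousMultilinearMapLI (𝕜 := ℝ) (E := E) (F := T)
      (ι := Fin k)).toLinearMap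
    (LinearMap.ker_eq_bot.2 (LinearIsometry.injective _))
  have h : ContDiff ℝ ∞ fun p : (F [⋀^Fin k]→L[ℝ] T) × (E →L[ℝ] F) =>
      (ContinuousMultilinearMap.compContinuousLinearMapContinuousMultilinear ℝ
        (fun _ : Fin k => E) (fun _ => F) T (fun _ => p.2))
        ((ContinuousAlternatingMap.toContinuousMultilinearMapLI (𝕜 := ℝ) (E := F) (F := T)
          (ι := Fin k)) p.1) :=
    (((ContinuousMultilinearMap.contDiff _).comp (contDiff_pi.2 fun _ => contDiff_snd))).clm_apply
      ((LinearIsometry.contDiff _).comp contDiff_fst)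
  convert! l.toContinuousLinearMap.contDiff.comp h using 2 with p
  exact (LinearMap.congr_fun hl (p.1.compContinuousLinearMap p.2)).symm

end Alternating

/-! ### Superposition operators -/

section Superposition

open ContinuousMap

universe u v

/-- Pointwise application of a continuous family of linear maps to a continuous map. -/
def pointwiseApply (K : Type*) [TopologicalSpace K] [CompactSpace K] (X Y : Type*)
    [NormedAddCommGroup X] [NormedSpace ℝ X] [NormedAddCommGroup Y] [NormedSpace ℝ Y] :
    C(K, X →L[ℝ] Y) →L[ℝ] C(K, X) →L[ℝ] C(K, Y) :=
  LinearMap.mkContinuous₂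
    (LinearMap.mk₂ ℝ
      (fun (A : C(K, X →L[ℝ] Y)) (u : C(K, X)) => (⟨fun t => A t (u t), by fun_prop⟩ : C(K, Y)))
      (fun _ _ _ => by ext; simp) (fun _ _ _ => by ext; simp) (fun _ _ _ => by ext; simp)
      (fun _ _ _ => by ext; simp)) 1 fun A u => by
    rw [one_mul, ContinuousMap.norm_le _ (by positivity)]
    intro t
    exact (A t).le_opNorm_of_le (u.norm_coe_le_norm t) |>.trans
      (by gcongr; exact A.norm_coe_le_norm t)

variable {K : Type*} [TopologicalSpace K] [CompactSpace K]

@[simp]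
theorem pointwiseApply_apply {X Y : Type*}
    [NormedAddCommGroup X] [NormedSpace ℝ X] [NormedAddCommGroup Y] [NormedSpace ℝ Y]
    (A : C(K, X →L[ℝ] Y)) (u : C(K, X)) (t : K) : pointwiseApply K X Y A u t = A t (u t) := rfl

theorem contDiff_pointwiseApply {X Y : Type*}
    [NormedAddCommGroup X] [NormedSpace ℝ X] [NormedAddCommGroup Y] [NormedSpace ℝ Y]
    {n : WithTop ℕ∞} : ContDiff ℝ n (pointwiseApply K X Y) := by
  apply ContinuousLinearMap.contDiff

/-- The mean value inequality at each `t` gives the estimate, provided `f'` oscillates little near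
`u t` uniformly in `t`. -/
theorem hasFDerivAt_postcomp {X Y : Type*}
    [NormedAddCommGroup X] [NormedSpace ℝ X] [NormedAddCommGroup Y] [NormedSpace ℝ Y]
    (f : C(X, Y)) (f' : C(X, X →L[ℝ] Y)) (hf : ∀ x, HasFDerivAt f (f' x) x) (u : C(K, X)) :
    HasFDerivAt (fun v : C(K, X) => f.comp v) (pointwiseApply K X Y (f'.comp u)) u := by
  rw [hasFDerivAt_iff_isLittleO, Asymptotics.isLittleO_iff]
  intro ε hε
  have hc : ContinuousAt (fun v : C(K, X) => f'.comp v) u :=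
    f'.continuous_postcomp.continuousAt
  obtain ⟨δ, hδ, h⟩ := (Metric.continuousAt_iff (α := C(K, X)) (β := C(K, X →L[ℝ] Y))).1 hc ε hε
  filter_upwards [Metric.ball_mem_nhds u hδ] with v hv
  rw [ContinuousMap.norm_le _ (by positivity)]
  intro t
  -- Continuity of `v ↦ f' ∘ v` is tested on the translate of `u` by the constant `y - u t`, so one
  -- `δ` serves every `t`.
  have key : ∀ y ∈ Metric.ball (u t) δ, ‖f' y - f' (u t)‖ ≤ ε := by
    intro y hy
    have h1 : dist (u + ContinuousMap.const K (y - u t)) u < δ := by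
      rw [ContinuousMap.dist_lt_iff hδ]
      intro s
      simpa [dist_eq_norm] using hy
    have h2 := (ContinuousMap.dist_apply_le_dist t).trans (h h1).le
    simpa [dist_eq_norm] using h2
  have hvt : v t ∈ Metric.ball (u t) δ := (ContinuousMap.dist_apply_le_dist t).trans_lt hv
  refine ((convex_ball (u t) δ).norm_image_sub_le_of_norm_hasFDerivWithin_le'
    (fun x _ => (hf x).hasFDerivWithinAt) key (Metric.mem_ball_self hδ) hvt).trans ?_
  gcongr
  exact (v - u).norm_coe_le_norm t

/-- The derivative of a superposition operator is built from the superposition operator of `fderiv ℝ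
f`, hence the induction on `n` with `Y` varying. The universe `max u v` is stable under passing from
`Y` to `X →L[ℝ] Y`. -/
theorem contDiff_postcomp_aux {X : Type u} [NormedAddCommGroup X] [NormedSpace ℝ X] (n : ℕ) :
    ∀ {Y : Type max u v} [NormedAddCommGroup Y] [NormedSpace ℝ Y] (f : C(X, Y)),
      ContDiff ℝ ∞ f → ContDiff ℝ n (fun v : C(K, X) => f.comp v) := by
  induction n with
  | zero =>
    intro Y _ _ f _
    exact contDiff_zero.2 f.continuous_postcomp
  | succ n ih =>
    intro Y _ _ f hf
    have hf' : ContDiff ℝ ∞ (fderiv ℝ f) := hf.fderiv_right (by simp)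
    let f' : C(X, X →L[ℝ] Y) := ⟨fderiv ℝ f, hf'.continuous⟩
    have h : ContDiff ℝ n fun u : C(K, X) => pointwiseApply K X Y (f'.comp u) :=
      contDiff_pointwiseApply.comp (ih f' hf')
    exact contDiff_succ_iff_hasFDerivAt.2
      ⟨_, h, hasFDerivAt_postcomp f _ fun x => (hf.differentiable (by simp) x).hasFDerivAt⟩

/-- The superposition operator of a smooth map is smooth. -/
theorem contDiff_postcomp {X : Type u} {Y : Type v}
    [NormedAddCommGroup X] [NormedSpace ℝ X] [NormedAddCommGroup Y] [NormedSpace ℝ Y]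
    (f : C(X, Y)) (hf : ContDiff ℝ ∞ f) : ContDiff ℝ ∞ (fun v : C(K, X) => f.comp v) := by
  let e : ULift.{u} Y ≃L[ℝ] Y := ContinuousLinearEquiv.ulift
  let g : C(X, ULift.{u} Y) := ⟨e.symm ∘ f, e.symm.continuous.comp f.continuous⟩
  have hg : ContDiff ℝ ∞ g := e.symm.contDiff.comp hf
  have h := ((e : ULift.{u} Y →L[ℝ] Y).compLeftContinuous ℝ K).contDiff.comp
    (contDiff_infty.2 fun n => contDiff_postcomp_aux (K := K) n g hg)
  exact h

end Superposition

/-! ### Integrals of curves -/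

section Integral

open unitInterval

variable {E Y : Type*} [NormedAddCommGroup E] [NormedSpace ℝ E]
  [NormedAddCommGroup Y] [NormedSpace ℝ Y] [CompleteSpace Y]

/-- The extension of a curve on the unit interval by constants. -/
abbrev extendCurve {Z : Type*} [TopologicalSpace Z] (u : C(I, Z)) (s : ℝ) : Z :=
  u (projIcc 0 1 zero_le_one s)

theorem continuous_extendCurve {Z : Type*} [TopologicalSpace Z] (u : C(I, Z)) :
    Continuous (extendCurve u) :=
  u.continuous.comp continuous_projIcc

theorem hasDerivAt_integral_extendCurve (u : C(I, Y)) (t : ℝ) :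
    HasDerivAt (fun t => ∫ s in (0 : ℝ)..t, extendCurve u s) (extendCurve u t) t :=
  intervalIntegral.integral_hasDerivAt_right
    ((continuous_extendCurve u).intervalIntegrable _ _)
    ((continuous_extendCurve u).stronglyMeasurableAtFilter _ _)
    (continuous_extendCurve u).continuousAt

omit [CompleteSpace Y] [NormedSpace ℝ Y] in
theorem intervalIntegrable_extendCurve (u : C(I, Y)) (a b : ℝ) :
    IntervalIntegrable (extendCurve u) MeasureTheory.volume a b :=
  (continuous_extendCurve u).intervalIntegrable _ _

/-- The primitive vanishing at `0` of a curve. -/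
def primitive (Y : Type*) [NormedAddCommGroup Y] [NormedSpace ℝ Y] [CompleteSpace Y] :
    C(I, Y) →L[ℝ] C(I, Y) :=
  LinearMap.mkContinuous
    { toFun := fun u => ⟨fun t => ∫ s in (0 : ℝ)..t, extendCurve u s,
        (continuous_iff_continuousAt.2 fun t =>
          (hasDerivAt_integral_extendCurve u t).continuousAt).comp continuous_subtype_val⟩
      map_add' := fun u v => by
        ext t
        exact intervalIntegral.integral_add (intervalIntegrable_extendCurve u 0 t)
          (intervalIntegrable_extendCurve v 0 t)
      map_smul' := fun c u => by
        ext t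
        exact intervalIntegral.integral_smul c (extendCurve u) } 1 fun u => by
    rw [one_mul, ContinuousMap.norm_le _ (norm_nonneg _)]
    intro t
    refine (intervalIntegral.norm_integral_le_of_norm_le_const
      fun s _ => u.norm_coe_le_norm _).trans ?_
    have h0 := t.2.1
    have h1 := t.2.2
    rw [sub_zero, abs_of_nonneg h0]
    exact mul_le_of_le_one_right (norm_nonneg _) h1

theorem primitive_apply (u : C(I, Y)) (t : I) :
    primitive Y u t = ∫ s in (0 : ℝ)..t, extendCurve u s := rfl

theorem contDiff_primitive {n : WithTop ℕ∞} : ContDiff ℝ n (primitive Y) := by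
  apply ContinuousLinearMap.contDiff

theorem hasFDerivAt_primitive (u : C(I, Y)) : HasFDerivAt (primitive Y) (primitive Y) u := by
  apply ContinuousLinearMap.hasFDerivAt

theorem contDiff_eval {K Z : Type*} [TopologicalSpace K] [CompactSpace K] [NormedAddCommGroup Z]
    [NormedSpace ℝ Z] {n : WithTop ℕ∞} (t : K) : ContDiff ℝ n fun u : C(K, Z) => u t := by
  exact ContinuousLinearMap.contDiff (E := C(K, Z)) (ContinuousMap.evalCLM ℝ t)

theorem hasFDerivAt_eval {K Z : Type*} [TopologicalSpace K] [CompactSpace K]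
    [NormedAddCommGroup Z] [NormedSpace ℝ Z] (t : K) (u : C(K, Z)) :
    HasFDerivAt (fun u : C(K, Z) => u t) (ContinuousMap.evalCLM ℝ t) u := by
  exact ContinuousLinearMap.hasFDerivAt (E := C(K, Z)) (ContinuousMap.evalCLM ℝ t)

/-- The curve `t ↦ (a t, x)`, depending linearly on `(a, x)`. -/
def prodConst (Z E : Type*) [NormedAddCommGroup Z] [NormedSpace ℝ Z] [NormedAddCommGroup E]
    [NormedSpace ℝ E] : C(I, Z) × E →L[ℝ] C(I, Z × E) :=
  ((ContinuousLinearMap.inl ℝ Z E).compLeftContinuous ℝ I).comp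
      (ContinuousLinearMap.fst ℝ C(I, Z) E) +
    (((ContinuousLinearMap.inr ℝ Z E).compLeftContinuous ℝ I).comp
      (ContinuousLinearMap.const ℝ I)).comp (ContinuousLinearMap.snd ℝ C(I, Z) E)

@[simp]
theorem prodConst_apply {Z : Type*} [NormedAddCommGroup Z] [NormedSpace ℝ Z]
    (p : C(I, Z) × E) (t : I) : prodConst Z E p t = (p.1 t, p.2) := by
  simp [prodConst]

theorem contDiff_prodConst {Z : Type*} [NormedAddCommGroup Z] [NormedSpace ℝ Z]
    {n : WithTop ℕ∞} : ContDiff ℝ n (prodConst Z E) := by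
  apply ContinuousLinearMap.contDiff

theorem hasFDerivAt_prodConst {Z : Type*} [NormedAddCommGroup Z] [NormedSpace ℝ Z]
    (p : C(I, Z) × E) : HasFDerivAt (prodConst Z E) (prodConst Z E) p := by
  apply ContinuousLinearMap.hasFDerivAt

/-- The inclusion of the unit interval into the line. -/
def idCurve : C(I, ℝ) := ⟨Subtype.val, continuous_subtype_val⟩

/-- Writing a parametric integral as linear maps around a superposition operator yields its
smoothness and its derivative by the chain rule. -/
theorem intervalIntegral_eq_primitive {g : ℝ × E → Y} (hg : Continuous g) (x : E) :
    ∫ t in (0 : ℝ)..1, g (t, x) =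
      primitive Y ((⟨g, hg⟩ : C(ℝ × E, Y)).comp (prodConst ℝ E (idCurve, x))) 1 := by
  rw [primitive_apply]
  refine intervalIntegral.integral_congr fun t ht => ?_
  rw [uIcc_of_le zero_le_one] at ht
  simp [projIcc_of_mem _ ht, idCurve]

theorem contDiff_intervalIntegral {g : ℝ × E → Y} (hg : ContDiff ℝ ∞ g) :
    ContDiff ℝ ∞ fun x => ∫ t in (0 : ℝ)..1, g (t, x) := by
  simp only [intervalIntegral_eq_primitive hg.continuous]
  exact (contDiff_eval 1).comp (contDiff_primitive.comp ((contDiff_postcomp _ hg).comp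
    (contDiff_prodConst.comp (contDiff_const.prodMk contDiff_id))))

theorem hasFDerivAt_intervalIntegral {g : ℝ × E → Y} (hg : ContDiff ℝ ∞ g) (x : E) :
    HasFDerivAt (fun x => ∫ t in (0 : ℝ)..1, g (t, x))
      (∫ t in (0 : ℝ)..1, fderiv ℝ (fun x => g (t, x)) x) x := by
  have hd : ∀ p, HasFDerivAt g (fderiv ℝ g p) p := fun p =>
    (hg.differentiable (by simp) p).hasFDerivAt
  have hpart : ∀ t : ℝ, HasFDerivAt (fun x => g (t, x))
      ((fderiv ℝ g (t, x)).comp (ContinuousLinearMap.inr ℝ ℝ E)) x := fun t =>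
    (hd (t, x)).comp x (hasFDerivAt_prodMk_right t x)
  have hint : Continuous fun t : ℝ =>
      (fderiv ℝ g (t, x)).comp (ContinuousLinearMap.inr ℝ ℝ E) := by
    have := (hg.continuous_fderiv (by simp)).comp (Continuous.prodMk_left x)
    exact this.clm_comp continuous_const
  simp only [(hpart _).fderiv]
  let Dg : C(ℝ × E, ℝ × E →L[ℝ] Y) := ⟨fderiv ℝ g, hg.continuous_fderiv (by simp)⟩
  have hP : HasFDerivAt (fun x : E => prodConst ℝ E (idCurve, x))
      ((prodConst ℝ E).comp (ContinuousLinearMap.inr ℝ C(I, ℝ) E)) x :=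
    (hasFDerivAt_prodConst _).comp x (hasFDerivAt_prodMk_right idCurve x)
  have hN := (hasFDerivAt_postcomp (⟨g, hg.continuous⟩ : C(ℝ × E, Y)) Dg hd _).comp x hP
  have hJ := (hasFDerivAt_primitive _).comp x hN
  have hE := (hasFDerivAt_eval (Z := Y) (1 : I) _).comp x hJ
  simp only [intervalIntegral_eq_primitive hg.continuous]
  convert! hE using 1
  ext w
  rw [ContinuousLinearMap.intervalIntegral_apply (hint.intervalIntegrable _ _)]
  refine (intervalIntegral_eq_primitive (g := fun p => fderiv ℝ g p (0, w))
    ((hg.continuous_fderiv (by simp)).clm_apply continuous_const) x).trans ?_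
  -- Only `x` varies, so the curve `t ↦ (t, x)` varies by the constant curve `(0, w)`.
  change _ = primitive Y (pointwiseApply I (ℝ × E) Y _ (prodConst ℝ E (0, w))) 1
  congr 2
  ext t
  simp [Dg]

omit [CompleteSpace Y] in
theorem continuous_fderiv_partial {g : ℝ × E → Y} (hg : ContDiff ℝ ∞ g) (x : E) :
    Continuous fun t => fderiv ℝ (fun x => g (t, x)) x :=
  (ContDiff.fderiv (f := fun t x => g (t, x)) (g := fun _ : ℝ => x) (n := 0) (m := ∞)
    hg contDiff_const (by simp)).continuous

theorem clm_intervalIntegral_fderiv {Z : Type*} [NormedAddCommGroup Z] [NormedSpace ℝ Z]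
    [CompleteSpace Z] (A : (E →L[ℝ] Y) →L[ℝ] Z) {g : ℝ × E → Y} (hg : ContDiff ℝ ∞ g) (x : E) :
    A (∫ t in (0 : ℝ)..1, fderiv ℝ (fun x => g (t, x)) x) =
      ∫ t in (0 : ℝ)..1, A (fderiv ℝ (fun x => g (t, x)) x) :=
  (A.intervalIntegral_comp_comm ((continuous_fderiv_partial hg x).intervalIntegrable 0 1)).symm

end Integral

/-! ### The homotopy operator -/

section Homotopy

open ContinuousAlternatingMap

variable {E T : Type*} [NormedAddCommGroup E] [NormedSpace ℝ E] [NormedAddCommGroup T]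
  [NormedSpace ℝ T] {k : ℕ}

/-- The linear homotopy from `Q` to `Q + R`. -/
def linHomotopy (Q R : E →L[ℝ] E) (t : ℝ) : E →L[ℝ] E := Q + t • R

/-- Cartan's formula for the constant field `e`, pulled back by `h`, with `D` the derivative of a
form closed at the point. In `hD` evaluated at `(e, h v)`, the leading term is `D e` and the others
are the alternation with opposite sign. -/
theorem alternatizeUncurryFin_curryLeft_comp (D : E →L[ℝ] E [⋀^Fin (k + 1)]→L[ℝ] T)
    (hD : alternatizeUncurryFin D = 0) (h : E →L[ℝ] E) (e : E) :
    alternatizeUncurryFin ((compContinuousLinearMapCLM h).comp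
      (((curryLeftLI (𝕜 := ℝ) (E := E) (F := T) (n := k)).toContinuousLinearMap.flip e).comp
        (D.comp h))) = (D e).compContinuousLinearMap h := by
  ext v
  have h0 := congrArg (fun α => α (Fin.cons e (h ∘ v))) hD
  simp only [alternatizeUncurryFin_apply, Fin.sum_univ_succ (n := k + 1)] at h0
  rw [Fin.cons_zero, Fin.val_zero, pow_zero, one_smul, Fin.removeNth_zero, Fin.tail_cons,
    ContinuousAlternatingMap.coe_zero, Pi.zero_apply, add_eq_zero_iff_eq_neg, ← Finset.sum_neg_distrib] at h0
  refine (alternatizeUncurryFin_apply _ _).trans (Eq.trans ?_ h0.symm)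
  refine Finset.sum_congr rfl fun i _ => ?_
  rw [Fin.cons_succ, Fin.val_succ, pow_succ, mul_neg_one, neg_smul, neg_neg]
  congr 1
  change D (h (v i)) _ = D (h (v i)) _
  congr 1
  funext j
  cases j using Fin.cases with
  | zero => simp [Fin.removeNth]
  | succ j => simp [Fin.removeNth]

/-- Infinitesimal homotopy formula: `R x` is the velocity of `t ↦ Q x + t • R x`, and closedness
leaves only the exact term of Cartan's formula. -/
theorem hasDerivAt_pullback_linHomotopy {η : E → E [⋀^Fin (k + 1)]→L[ℝ] T} (Q R : E →L[ℝ] E)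
    (t : ℝ) (x : E) (hη : DifferentiableAt ℝ η (linHomotopy Q R t x))
    (hd : extDeriv η (linHomotopy Q R t x) = 0) :
    HasDerivAt (fun t => (η (linHomotopy Q R t x)).compContinuousLinearMap (linHomotopy Q R t))
      (extDeriv (fun x => ((η (linHomotopy Q R t x)).curryLeft (R x)).compContinuousLinearMap
        (linHomotopy Q R t)) x) t := by
  have hh : HasDerivAt (linHomotopy Q R) R t := by
    have := ((hasDerivAt_id t).smul_const R).const_add Q
    rwa [one_smul] at this
  have hhx : HasDerivAt (fun t => linHomotopy Q R t x) (R x) t := by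
    simpa using hh.clm_apply (hasDerivAt_const t x)
  have h1 := (hη.hasFDerivAt.comp_hasDerivAt t hhx).hasFDerivAt
    |>.continuousAlternatingMapCompContinuousLinearMap hh.hasFDerivAt |>.hasDerivAt
  convert! h1 using 1
  set h := linHomotopy Q R t
  set D := fderiv ℝ η (h x)
  have h2 : HasFDerivAt (fun x => (curryLeftLI (𝕜 := ℝ) (E := E) (F := T) (n := k))
      (η (h x))) ((curryLeftLI (𝕜 := ℝ) (E := E) (F := T) (n := k)).toContinuousLinearMap.comp
        (D.comp h)) x :=
    HasFDerivAt.comp (g := (curryLeftLI (𝕜 := ℝ) (E := E) (F := T) (n := k)).toContinuousLinearMap)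
      x (ContinuousLinearMap.hasFDerivAt _) (hη.hasFDerivAt.comp x h.hasFDerivAt)
  have h3 := (compContinuousLinearMapCLM h : (E [⋀^Fin k]→L[ℝ] T) →L[ℝ] _).hasFDerivAt.comp x
    (h2.clm_apply R.hasFDerivAt)
  have h4 : extDeriv (fun x => ((η (h x)).curryLeft (R x)).compContinuousLinearMap h) x =
      alternatizeUncurryFin ((compContinuousLinearMapCLM h).comp
        (((curryLeftLI (𝕜 := ℝ) (E := E) (F := T) (n := k)).toContinuousLinearMap.flip
          (R x)).comp (D.comp h)) +
        ((compContinuousLinearMapCLM h).comp (η (h x)).curryLeft).comp R) := by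
    rw [extDeriv]
    congr 1
    refine HasFDerivAt.fderiv ?_
    convert! h3 using 1
    ext v w
    simp [add_comm]
  -- The first summand is the derivative of `η` along `R x`. The second, from differentiating `R x`
  -- in `x`, inserts `R` into the slots, as does the `t`-derivative of the pullback.
  rw [h4, alternatizeUncurryFin_add, alternatizeUncurryFin_curryLeft_comp D hd,
    fderivCompContinuousLinearMap_eq_alternatizeUncurryFin]
  simp
  rfl

variable [FiniteDimensional ℝ E] [FiniteDimensional ℝ T]

/-- The homotopy operator of the linear homotopy from `Q` to `Q + R`. -/
def homotopyOperator (Q R : E →L[ℝ] E) (η : E → E [⋀^Fin (k + 1)]→L[ℝ] T) (x : E) :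
    E [⋀^Fin k]→L[ℝ] T :=
  ∫ t in (0 : ℝ)..1, ((η (linHomotopy Q R t x)).curryLeft (R x)).compContinuousLinearMap
    (linHomotopy Q R t)

omit [FiniteDimensional ℝ E] in
theorem contDiff_linHomotopy (Q R : E →L[ℝ] E) : ContDiff ℝ ∞ (linHomotopy Q R) := by
  unfold linHomotopy; fun_prop

theorem contDiff_homotopyOperator_integrand (Q R : E →L[ℝ] E)
    {η : E → E [⋀^Fin (k + 1)]→L[ℝ] T} (hη : ContDiff ℝ ∞ η) :
    ContDiff ℝ ∞ fun p : ℝ × E =>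
      ((η (linHomotopy Q R p.1 p.2)).curryLeft (R p.2)).compContinuousLinearMap
        (linHomotopy Q R p.1) := by
  have h1 : ContDiff ℝ ∞ fun p : ℝ × E => linHomotopy Q R p.1 :=
    (contDiff_linHomotopy Q R).comp contDiff_fst
  have h2 : ContDiff ℝ ∞ fun p : ℝ × E => (curryLeftLI (𝕜 := ℝ) (E := E) (F := T) (n := k))
      (η (linHomotopy Q R p.1 p.2)) :=
    (LinearIsometry.contDiff _).comp (hη.comp (h1.clm_apply contDiff_snd))
  exact (contDiff_compContinuousLinearMap k).comp
    ((h2.clm_apply (R.contDiff.comp contDiff_snd)).prodMk h1)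

theorem contDiff_homotopyOperator (Q R : E →L[ℝ] E)
    {η : E → E [⋀^Fin (k + 1)]→L[ℝ] T} (hη : ContDiff ℝ ∞ η) :
    ContDiff ℝ ∞ (homotopyOperator Q R η) :=
  contDiff_intervalIntegral (contDiff_homotopyOperator_integrand Q R hη)

theorem homotopyOperator_apply (Q R : E →L[ℝ] E)
    {η : E → E [⋀^Fin (k + 1)]→L[ℝ] T} (hη : ContDiff ℝ ∞ η) (x : E) (v : Fin k → E) :
    homotopyOperator Q R η x v = ∫ t in (0 : ℝ)..1,
      η (linHomotopy Q R t x) (Matrix.vecCons (R x) (linHomotopy Q R t ∘ v)) :=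
  ((ContinuousAlternatingMap.apply ℝ E T v).intervalIntegral_comp_comm
    (((contDiff_homotopyOperator_integrand Q R hη).continuous.comp
      (Continuous.prodMk_left x)).intervalIntegrable 0 1)).symm

/-- The homotopy formula for closed forms. -/
theorem extDeriv_homotopyOperator (Q R : E →L[ℝ] E)
    {η : E → E [⋀^Fin (k + 1)]→L[ℝ] T} (hη : ContDiff ℝ ∞ η) (x : E)
    (hd : ∀ t ∈ Icc (0 : ℝ) 1, extDeriv η (linHomotopy Q R t x) = 0) :
    extDeriv (homotopyOperator Q R η) x =
      (η ((Q + R) x)).compContinuousLinearMap (Q + R) -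
        (η (Q x)).compContinuousLinearMap Q := by
  have hg := contDiff_homotopyOperator_integrand Q R hη
  have h1 := hasFDerivAt_intervalIntegral hg x
  have hcont := (alternatizeUncurryFinCLM ℝ E T).continuous.comp
    (continuous_fderiv_partial (Y := E [⋀^Fin k]→L[ℝ] T) hg x)
  rw [extDeriv, HasFDerivAt.fderiv (f := homotopyOperator Q R η) h1,
    ← alternatizeUncurryFinCLM_apply]
  refine (clm_intervalIntegral_fderiv (alternatizeUncurryFinCLM ℝ E T) hg x).trans ?_
  -- The integrand is now a `t`-derivative of pullbacks, so the integral is the difference of the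
  -- endpoints.
  rw [intervalIntegral.integral_eq_sub_of_hasDerivAt
    (f := fun t => (η (linHomotopy Q R t x)).compContinuousLinearMap (linHomotopy Q R t))]
  · simp [linHomotopy]
  · intro t ht
    rw [uIcc_of_le zero_le_one] at ht
    exact hasDerivAt_pullback_linHomotopy Q R t x (hη.differentiable (by simp) _) (hd t ht)
  · exact hcont.intervalIntegrable _ _

/-- The Poincaré lemma for forms which are horizontal with respect to a linear foliation, whose
leaves are the translates of the range of the projection `R`. -/
theorem exists_primitive_of_linear {Q R : E →L[ℝ] E} (hQR : Q + R = 1) (hR : R ∘L R = R)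
    {U : Set E} (hU : ∀ x ∈ U, ∀ s ∈ Icc (0 : ℝ) 1, ∀ t ∈ Icc (0 : ℝ) 1, s • Q x + t • R x ∈ U)
    {η : E → E [⋀^Fin (k + 1)]→L[ℝ] T} (hη : ContDiff ℝ ∞ η) (hd : ∀ x ∈ U, extDeriv η x = 0)
    {r : ℕ} (hr : 1 ≤ r)
    (hhor : ∀ x ∈ U, ContractionsVanish R.range (r + 1) (k + 1) (η x).toAlternatingMap) :
    ∃ θ : E → E [⋀^Fin k]→L[ℝ] T, ContDiff ℝ ∞ θ ∧
      (∀ x ∈ U, ContractionsVanish R.range r k (θ x).toAlternatingMap) ∧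
      ∀ x ∈ U, extDeriv θ x = η x := by
  have hQR' : ∀ y, Q (R y) = 0 := fun y => by
    have h1 := DFunLike.congr_fun hQR (R y)
    have h2 := DFunLike.congr_fun hR y
    simp only [_root_.add_apply, one_apply_eq_self,
      ContinuousLinearMap.comp_apply] at h1 h2
    rwa [h2, add_eq_right] at h1
  -- The remainder `Q^*η`, to be integrated by the radial homotopy from `0` to the identity.
  let η₁ : E → E [⋀^Fin (k + 1)]→L[ℝ] T := fun x => (η (Q x)).compContinuousLinearMap Q
  have hη₁ : ContDiff ℝ ∞ η₁ :=
    (contDiff_compContinuousLinearMap _).comp ((hη.comp Q.contDiff).prodMk contDiff_const)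
  have hd₁ : ∀ x ∈ U, extDeriv η₁ x = 0 := fun x hx => by
    have h1 := extDeriv_pullback (x := x) (f := Q) (r := 2)
      (hη.differentiable (by simp) _) Q.contDiff.contDiffAt (by simp)
    simp only [ContinuousLinearMap.fderiv] at h1
    have h2 := hU x hx 1 (by simp) 0 (by simp)
    rw [one_smul, zero_smul, add_zero] at h2
    rw [h1, hd _ h2]
    rfl
  have hU₁ : ∀ x ∈ U, ∀ t ∈ Icc (0 : ℝ) 1, linHomotopy Q R t x ∈ U := fun x hx t ht => by
    simpa [linHomotopy] using hU x hx 1 (by simp) t ht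
  have hU₂ : ∀ x ∈ U, ∀ t ∈ Icc (0 : ℝ) 1, linHomotopy 0 1 t x ∈ U := fun x hx t ht => by
    have h1 := hU x hx t ht t ht
    rw [← smul_add, ← _root_.add_apply, hQR] at h1
    simpa [linHomotopy] using h1
  have hK := contDiff_homotopyOperator Q R hη
  have hK₁ := contDiff_homotopyOperator 0 1 hη₁
  refine ⟨homotopyOperator Q R η + homotopyOperator 0 1 η₁, hK.add hK₁, fun x hx => ?_,
    fun x hx => ?_⟩
  · rw [contractionsVanish_iff]
    intro hrk w hw
    change homotopyOperator Q R η x w + homotopyOperator 0 1 η₁ x w = 0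
    rw [homotopyOperator_apply Q R hη, homotopyOperator_apply 0 1 hη₁,
      intervalIntegral.integral_zero_ae, intervalIntegral.integral_zero_ae, add_zero]
    -- Radial part: as `1 ≤ r ≤ k`, the slot of `w 0` exists and holds a vector of the range of `R`,
    -- which `Q` kills.
    · refine Filter.Eventually.of_forall fun t ht => ?_
      obtain ⟨y, hy⟩ := hw ⟨0, by omega⟩ (by exact hr)
      refine ContinuousAlternatingMap.map_coord_zero (η (Q (linHomotopy 0 1 t x)))
        (m := Q ∘ _) (Fin.succ ⟨0, by omega⟩) ?_
      simp only [Function.comp_apply, Matrix.cons_val_succ, ← hy]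
      simp [linHomotopy, hQR']
    -- Leafwise part: `R x` and the images `t • R y` of the first `r` vectors make `r + 1` vectors
    -- of the range of `R`.
    · refine Filter.Eventually.of_forall fun t ht => ?_
      rw [uIoc_of_le zero_le_one] at ht
      refine (contractionsVanish_iff _ _ _ _).1 (hhor _ (hU₁ x hx t (Ioc_subset_Icc_self ht)))
        (by omega) _ fun i hi => ?_
      cases i using Fin.cases with
      | zero => exact ⟨x, rfl⟩
      | succ i =>
        obtain ⟨y, hy⟩ := hw i (by simpa using hi)
        refine ⟨t • y, ?_⟩
        have h2 := DFunLike.congr_fun hR y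
        simp only [ContinuousLinearMap.comp_apply] at h2
        simp only [Function.comp_apply, Matrix.cons_val_succ, ← hy]
        simp [linHomotopy, hQR', h2]
  · rw [extDeriv_add (hK.differentiable (by simp) x) (hK₁.differentiable (by simp) x),
      extDeriv_homotopyOperator Q R hη x fun t ht => hd _ (hU₁ x hx t ht),
      extDeriv_homotopyOperator 0 1 hη₁ x fun t ht => hd₁ _ (hU₂ x hx t ht), hQR, zero_add]
    -- The degree `k + 1` is positive, so the pullback under the zero map vanishes.
    have h0 : (η₁ ((0 : E →L[ℝ] E) x)).compContinuousLinearMap (0 : E →L[ℝ] E) = 0 := by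
      ext v
      exact ContinuousAlternatingMap.map_coord_zero (η₁ _) (m := fun i => (0 : E →L[ℝ] E) (v i))
        (0 : Fin (k + 1)) rfl
    rw [h0, sub_zero]
    ext v
    simp [η₁]

end Homotopy

/-! ### Straightening of commuting frames -/

/-- The inverse function theorem for a map which is smooth on an open set. -/
theorem exists_openPartialHomeomorph_contDiffOn {X Y : Type*} [NormedAddCommGroup X]
    [NormedSpace ℝ X] [CompleteSpace X] [NormedAddCommGroup Y] [NormedSpace ℝ Y] {f : X → Y}
    {s : Set X} (hs : IsOpen s) {a : X} (ha : a ∈ s) (hf : ContDiffOn ℝ ∞ f s) (f' : X ≃L[ℝ] Y)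
    (hf' : fderiv ℝ f a = f') :
    ∃ e : OpenPartialHomeomorph X Y, a ∈ e.source ∧ e.source ⊆ s ∧ ⇑e = f ∧
      ContDiffOn ℝ ∞ e.symm e.target := by
  have hfa : ∀ x ∈ s, ContDiffAt ℝ ∞ f x := fun x hx => hf.contDiffAt (hs.mem_nhds hx)
  have hd : HasFDerivAt f (f' : X →L[ℝ] Y) a :=
    hf' ▸ ((hfa a ha).differentiableAt (by simp)).hasFDerivAt
  let e₀ := (hfa a ha).toOpenPartialHomeomorph f hd (by simp)
  -- Restricting to the open set of invertible derivatives makes the inverse smooth on the whole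
  -- target.
  let s' : Set X := s ∩ fderiv ℝ f ⁻¹' range ((↑) : (X ≃L[ℝ] Y) → X →L[ℝ] Y)
  have hs' : IsOpen s' :=
    (hf.continuousOn_fderiv_of_isOpen hs (by simp)).isOpen_inter_preimage hs
      ContinuousLinearEquiv.isOpen
  refine ⟨e₀.restrOpen s' hs', ?_, fun x hx => hx.2.1, rfl, fun y hy => ?_⟩
  · exact ⟨(hfa a ha).mem_toOpenPartialHomeomorph_source hd (by simp), ha, f', hf'.symm⟩
  · obtain ⟨-, hx, g', hg'⟩ := (e₀.restrOpen s' hs').map_target hy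
    refine ((e₀.restrOpen s' hs').contDiffAt_symm hy (f₀' := g') ?_ (hfa _ hx)).contDiffWithinAt
    rw [hg']
    exact ((hfa _ hx).differentiableAt (by simp)).hasFDerivAt

section Straightening

open unitInterval

variable {E : Type*} [NormedAddCommGroup E] [NormedSpace ℝ E]

/-- Along an integral curve `U` of `y ↦ F y x`, the solution of the linearised equation with
inhomogeneity `F (U t) w` which vanishes at `0` is `t • F (U t) w`, if the fields commute. -/
theorem linearized_solution_eq {F : E → E →L[ℝ] E} (hF : ContDiff ℝ ∞ F) {x w : E} {U V : ℝ → E}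
    (hU : ∀ t ∈ Icc (0 : ℝ) 1, HasDerivAt U (F (U t) x) t)
    (hV : ∀ t ∈ Icc (0 : ℝ) 1, HasDerivAt V (fderiv ℝ F (U t) (V t) x + F (U t) w) t)
    (hV0 : V 0 = 0)
    (hsymm : ∀ t ∈ Icc (0 : ℝ) 1, fderiv ℝ F (U t) (F (U t) x) w = fderiv ℝ F (U t) (F (U t) w) x) :
    V 1 = F (U 1) w := by
  -- By `hsymm` the difference solves the homogeneous linear equation; it starts at `0`, so Grönwall
  -- makes it vanish.
  have hd : ∀ t ∈ Icc (0 : ℝ) 1, HasDerivAt (fun t => V t - t • F (U t) w)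
      (fderiv ℝ F (U t) (V t - t • F (U t) w) x) t := fun t ht => by
    have h1 : HasDerivAt (fun t => F (U t)) (fderiv ℝ F (U t) (F (U t) x)) t :=
      ((hF.differentiable (by simp) _).hasFDerivAt).comp_hasDerivAt t (hU t ht)
    have h2 := (hV t ht).sub ((hasDerivAt_id t).smul (h1.clm_apply (hasDerivAt_const t w)))
    convert! h2 using 1
    simp only [map_sub, map_smul, sub_apply, smul_apply, map_zero, add_zero, id, one_smul,
      hsymm t ht]
    abel
  have hUc : ContinuousOn U (Icc 0 1) := fun t ht => (hU t ht).continuousAt.continuousWithinAt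
  have hA : ContinuousOn (fun t => ‖(fderiv ℝ F (U t)).flip x‖) (Icc (0 : ℝ) 1) :=
    ((((ContinuousLinearMap.flipₗᵢ ℝ E E E).continuous.comp
      (hF.continuous_fderiv (by simp))).comp_continuousOn hUc).clm_apply continuousOn_const).norm
  obtain ⟨K, hK⟩ := (isCompact_Icc.image_of_continuousOn hA).bddAbove
  have h0 := eq_zero_of_abs_deriv_le_mul_abs_self_of_eq_zero_right (K := K)
    (fun t ht => (hd t ht).continuousAt.continuousWithinAt)
    (fun t ht => (hd t (Ico_subset_Icc_self ht)).hasDerivWithinAt) (by simp [hV0])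
    (fun t ht => (((fderiv ℝ F (U t)).flip x).le_opNorm _).trans
      (by gcongr; exact hK (mem_image_of_mem _ (Ico_subset_Icc_self ht)))) 1 (by simp)
  simpa [sub_eq_zero] using h0

variable [CompleteSpace E]

/-- Smooth dependence on parameters for `u' = F u x`, `u 0 = y₀ + Q x`, near `x = 0`. -/
theorem exists_contDiffOn_curve {g : C(E × E, E)} (hg : ContDiff ℝ ∞ g) (hg0 : ∀ y, g (y, 0) = 0)
    (Q : E →L[ℝ] E) (y₀ : E) :
    ∃ (N : Set E) (ψ : E → C(I, E)), IsOpen N ∧ 0 ∈ N ∧ ContDiffOn ℝ ∞ ψ N ∧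
      ψ 0 = ContinuousMap.const I y₀ ∧ ∀ x ∈ N, ψ x = ContinuousMap.const I (y₀ + Q x) +
        primitive E (g.comp (prodConst E E (ψ x, x))) := by
  -- The zeros of `f` are the solutions of the integral equation.
  let f : E × C(I, E) → C(I, E) := fun p =>
    p.2 - ContinuousLinearMap.const ℝ I (y₀ + Q p.1) -
      primitive E (g.comp (prodConst E E (p.2, p.1)))
  have hconst : ContDiff ℝ ∞ fun x : E => (ContinuousLinearMap.const ℝ I x : C(I, E)) := by
    exact ContinuousLinearMap.contDiff (F := C(I, E)) (ContinuousLinearMap.const ℝ I)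
  have hf : ContDiff ℝ ∞ f := by
    refine (contDiff_snd.sub (hconst.comp (contDiff_const.add (Q.contDiff.comp contDiff_fst)))).sub
      (contDiff_primitive.comp ((contDiff_postcomp g hg).comp (contDiff_prodConst.comp
        (contDiff_snd.prodMk contDiff_fst))))
  have hf0 : ∀ u, f (0, u) = u - ContinuousMap.const I y₀ := fun u => by
    have h1 : g.comp (prodConst E E (u, 0)) = 0 := by ext t; simp [hg0]
    simp only [f, h1, map_zero, add_zero, sub_zero]
    rfl
  let p₀ : E × C(I, E) := (0, ContinuousMap.const I y₀)
  -- At `x = 0` the integral term vanishes by `hg0`, so the partial derivative in `u` is the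
  -- identity. Hence `(x, u) ↦ (x, f (x, u))` has a triangular, invertible derivative.
  have hinv : fderiv ℝ f p₀ ∘L .inr ℝ E C(I, E) = .id ℝ _ := by
    have h1 := ((hf.differentiable (by simp) p₀).hasFDerivAt).comp _
      (hasFDerivAt_prodMk_right (0 : E) (ContinuousMap.const I y₀))
    have h2 : f ∘ (fun u => ((0 : E), u)) = fun u => u - ContinuousMap.const I y₀ := funext hf0
    rw [h2] at h1
    exact h1.unique ((hasFDerivAt_id _).sub_const _)
  set A := fderiv ℝ f p₀ ∘L .inl ℝ E C(I, E)
  let f' : (E × C(I, E)) ≃L[ℝ] (E × C(I, E)) := ContinuousLinearEquiv.equivOfInverse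
    ((ContinuousLinearMap.fst ℝ E C(I, E)).prod
      (A ∘L ContinuousLinearMap.fst ℝ E C(I, E) + ContinuousLinearMap.snd ℝ E C(I, E)))
    ((ContinuousLinearMap.fst ℝ E C(I, E)).prod
      (ContinuousLinearMap.snd ℝ E C(I, E) - A ∘L ContinuousLinearMap.fst ℝ E C(I, E)))
    (fun p => by simp) (fun p => by simp)
  have hf' : fderiv ℝ (fun p => (p.1, f p)) p₀ = f' := by
    have h1 := (hasFDerivAt_fst (𝕜 := ℝ) (p := p₀)).prodMk
      (hf.differentiable (by simp) p₀).hasFDerivAt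
    refine h1.fderiv.trans (ContinuousLinearMap.ext fun p => Prod.ext rfl ?_)
    have h2 := DFunLike.congr_fun hinv p.2
    change fderiv ℝ f p₀ p = fderiv ℝ f p₀ (p.1, 0) + p.2
    change fderiv ℝ f p₀ (0, p.2) = p.2 at h2
    rw [← h2, ← map_add]
    simp
  obtain ⟨e, he₀, -, hef, hes⟩ := exists_openPartialHomeomorph_contDiffOn isOpen_univ
    (mem_univ p₀) (contDiff_fst.prodMk hf).contDiffOn f' hf'
  have hep₀ : e p₀ = (0, 0) := by simp [hef, p₀, hf0]
  have hemb : ContDiff ℝ ∞ fun x : E => (x, (0 : C(I, E))) := contDiff_id.prodMk contDiff_const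
  refine ⟨(fun x => (x, 0)) ⁻¹' e.target, fun x => (e.symm (x, 0)).2,
    e.open_target.preimage hemb.continuous, ?_, ?_, ?_, fun x hx => ?_⟩
  · change ((0 : E), (0 : C(I, E))) ∈ e.target
    rw [← hep₀]
    exact e.map_source he₀
  · exact contDiff_snd.comp_contDiffOn (hes.comp hemb.contDiffOn fun x hx => hx)
  · have h1 := e.left_inv he₀
    rw [hep₀] at h1
    simp [h1, p₀]
  · have h1 := e.right_inv hx
    rw [hef] at h1
    obtain ⟨h2, h3⟩ := Prod.ext_iff.1 h1
    simp only [f] at h2 h3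
    rw [h2, sub_eq_zero, sub_eq_iff_eq_add, add_comm] at h3
    exact h3

/-- The variational equation in integrated form, obtained by differentiating the integral equation
in `x`. -/
theorem hasFDerivAt_curve_apply {g : C(E × E, E)} (hg : ContDiff ℝ ∞ g) (Q : E →L[ℝ] E) (y₀ : E)
    {ψ : E → C(I, E)} {x : E} (hψ : DifferentiableAt ℝ ψ x)
    (h : ∀ᶠ x in 𝓝 x, ψ x = ContinuousMap.const I (y₀ + Q x) +
      primitive E (g.comp (prodConst E E (ψ x, x)))) (w : E) (t : I) :
    fderiv ℝ ψ x w t = Q w + ∫ s in (0 : ℝ)..t,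
      fderiv ℝ g (extendCurve (ψ x) s, x) (extendCurve (fderiv ℝ ψ x w) s, w) := by
  let Dg : C(E × E, E × E →L[ℝ] E) := ⟨fderiv ℝ g, hg.continuous_fderiv (by simp)⟩
  have h1 := (hasFDerivAt_postcomp g Dg
    (fun p => (hg.differentiable (by simp) p).hasFDerivAt) _).comp x
    ((hasFDerivAt_prodConst _).comp x (hψ.hasFDerivAt.prodMk (hasFDerivAt_id x)))
  have h2 := (hasFDerivAt_eval t _).comp x ((hasFDerivAt_primitive _).comp x h1)
  have h3 := (Q.hasFDerivAt (x := x)).const_add y₀ |>.add h2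
  have h4 : (fun x => ψ x t) =ᶠ[𝓝 x] fun x => y₀ + Q x +
      primitive E (g.comp (prodConst E E (ψ x, x))) t :=
    h.mono fun x hx => congrArg (fun u : C(I, E) => u t) hx
  have h5 := (hasFDerivAt_eval t _).comp x hψ.hasFDerivAt
  have h6 := DFunLike.congr_fun (h5.unique (h3.congr_of_eventuallyEq h4)) w
  refine h6.trans ?_
  change Q w + primitive E (pointwiseApply I (E × E) E _ (prodConst E E (fderiv ℝ ψ x w, w))) t = _
  rw [primitive_apply]
  congr 1
  refine intervalIntegral.integral_congr fun s _ => ?_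
  simp [Dg]

/-- A smooth family of commuting vector fields is straightened by a local diffeomorphism. -/
theorem exists_straightening {F : E → E →L[ℝ] E} (hF : ContDiff ℝ ∞ F) {Q R : E →L[ℝ] E}
    (hQR : Q + R = 1) {y₀ : E} (hF0 : F y₀ = R)
    (hsymm : ∀ᶠ y in 𝓝 y₀, ∀ a b, fderiv ℝ F y (F y a) b = fderiv ℝ F y (F y b) a) :
    ∃ (N : Set E) (Φ : E → E), IsOpen N ∧ 0 ∈ N ∧ ContDiffOn ℝ ∞ Φ N ∧ Φ 0 = y₀ ∧
      fderiv ℝ Φ 0 = .id ℝ E ∧ ∀ x ∈ N, ∀ w, Q w = 0 → fderiv ℝ Φ x w = F (Φ x) w := by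
  have hg : ContDiff ℝ ∞ fun p : E × E => F p.1 p.2 :=
    (hF.comp contDiff_fst).clm_apply contDiff_snd
  let g : C(E × E, E) := ⟨fun p => F p.1 p.2, hg.continuous⟩
  have hgd : ∀ y x v w, fderiv ℝ g (y, x) (v, w) = fderiv ℝ F y v x + F y w := fun y x v w => by
    have h1 : HasFDerivAt (fun p : E × E => F p.1)
        ((fderiv ℝ F y).comp (ContinuousLinearMap.fst ℝ E E)) (y, x) :=
      (hF.differentiable (by simp) y).hasFDerivAt.comp (y, x) hasFDerivAt_fst
    have h2 := h1.clm_apply (hasFDerivAt_snd (𝕜 := ℝ) (p := (y, x)))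
    rw [show ⇑g = fun p : E × E => F p.1 p.2 from rfl, h2.fderiv]
    simp [add_comm]
  obtain ⟨N, ψ, hN, h0N, hψ, hψ0, hψe⟩ := exists_contDiffOn_curve (g := g) hg (fun y => (F y).map_zero) Q y₀
  have hψd : ∀ x ∈ N, DifferentiableAt ℝ ψ x := fun x hx =>
    (hψ.contDiffAt (hN.mem_nhds hx)).differentiableAt (by simp)
  have hψe' : ∀ x ∈ N, ∀ᶠ x in 𝓝 x, ψ x = ContinuousMap.const I (y₀ + Q x) +
      primitive E (g.comp (prodConst E E (ψ x, x))) := fun x hx =>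
    Filter.mem_of_superset (hN.mem_nhds hx) hψe
  have hΦd : ∀ x, DifferentiableAt ℝ ψ x → ∀ w, fderiv ℝ (fun x => ψ x 1) x w =
      fderiv ℝ ψ x w 1 := fun x hx w => by
    have h1 := (hasFDerivAt_eval (1 : I) _).comp x hx.hasFDerivAt
    exact DFunLike.congr_fun h1.fderiv w
  obtain ⟨ε, hε, h⟩ := Metric.eventually_nhds_iff.1 hsymm
  -- The second condition keeps the whole curve where the fields commute.
  refine ⟨N ∩ ψ ⁻¹' Metric.ball (ψ 0) ε, fun x => ψ x 1,
    hψ.continuousOn.isOpen_inter_preimage hN Metric.isOpen_ball,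
    ⟨h0N, Metric.mem_ball_self hε⟩,
    (contDiff_eval 1).comp_contDiffOn (hψ.mono inter_subset_left), by simp [hψ0], ?_, ?_⟩
  -- At `x = 0` the curve is constant and the variation has velocity `R w`, so the derivative is `Q
  -- w + R w = w`.
  · ext w
    rw [hΦd 0 (hψd 0 h0N), hasFDerivAt_curve_apply hg Q y₀ (hψd 0 h0N) (hψe' 0 h0N)]
    simp only [hgd, map_zero, zero_add, hψ0]
    have := DFunLike.congr_fun hQR w
    simpa [hF0, extendCurve] using this
  · rintro x ⟨hx, hxε⟩ w hw
    have hxs : ∀ t, ∀ a b, fderiv ℝ F (ψ x t) (F (ψ x t) a) b =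
        fderiv ℝ F (ψ x t) (F (ψ x t) b) a := fun t => by
      have h2 : dist (ψ x t) (ψ 0 t) < ε := (ContinuousMap.dist_apply_le_dist t).trans_lt hxε
      rw [hψ0] at h2
      exact h h2
    have hxd := hψd x hx
    rw [hΦd x hxd]
    have hUval : ∀ t ∈ Icc (0 : ℝ) 1, y₀ + Q x + ∫ s in (0 : ℝ)..t,
        extendCurve (g.comp (prodConst E E (ψ x, x))) s = extendCurve (ψ x) t := fun t ht => by
      have h1 := congrArg (fun u : C(I, E) => u ⟨t, ht⟩) (hψe x hx)
      simp only [extendCurve, projIcc_of_mem _ ht]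
      exact h1.symm
    have hVval : ∀ t ∈ Icc (0 : ℝ) 1, ∫ s in (0 : ℝ)..t,
        fderiv ℝ g (extendCurve (ψ x) s, x) (extendCurve (fderiv ℝ ψ x w) s, w) =
          extendCurve (fderiv ℝ ψ x w) t := fun t ht => by
      have h1 := hasFDerivAt_curve_apply hg Q y₀ hxd (hψe' x hx) w ⟨t, ht⟩
      rw [hw, zero_add] at h1
      simp only [extendCurve, projIcc_of_mem _ ht] at h1 ⊢
      exact h1.symm
    have hVc : Continuous fun s : ℝ =>
        fderiv ℝ g (extendCurve (ψ x) s, x) (extendCurve (fderiv ℝ ψ x w) s, w) :=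
      ((hg.continuous_fderiv (by simp)).comp
        ((continuous_extendCurve _).prodMk continuous_const)).clm_apply
        ((continuous_extendCurve _).prodMk continuous_const)
    have h1 : (1 : ℝ) ∈ Icc (0 : ℝ) 1 := by simp
    -- The curves are extended from `[0, 1]` by their integral formulas, so that two-sided
    -- derivatives exist at the endpoints as well.
    have key := linearized_solution_eq (x := x) (w := w) hF
      (U := fun t => y₀ + Q x + ∫ s in (0 : ℝ)..t,
        extendCurve (g.comp (prodConst E E (ψ x, x))) s)
      (V := fun t => ∫ s in (0 : ℝ)..t,
        fderiv ℝ g (extendCurve (ψ x) s, x) (extendCurve (fderiv ℝ ψ x w) s, w))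
      (fun t ht => by
        rw [hUval t ht]
        convert! (hasDerivAt_integral_extendCurve (g.comp (prodConst E E (ψ x, x))) t).const_add
          (y₀ + Q x) using 1
        simp [g, extendCurve])
      (fun t ht => by
        rw [hUval t ht, hVval t ht, ← hgd _ x]
        exact (hVc.integral_hasStrictDerivAt 0 t).hasDerivAt)
      intervalIntegral.integral_same
      (fun t ht => by
        rw [hUval t ht]
        exact hxs _ x w)
    rw [hUval 1 h1, hVval 1 h1] at key
    simpa [extendCurve] using key

end Straightening

/-! ### The theorem on an open subset of a vector space -/

section Flat

variable {E : Type*} [NormedAddCommGroup E] [NormedSpace ℝ E]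

/-- A smooth frame of a distribution yields a smooth family of projections onto the distribution
with constant kernel. -/
theorem exists_projection_onto [FiniteDimensional ℝ E] {V : Set E} (hV : IsOpen V) {y₀ : E} (hy₀ : y₀ ∈ V)
    {L : E → Submodule ℝ E} {d : ℕ} {X : Fin d → E → E} (hX : ∀ i, ContDiffOn ℝ ∞ (X i) V)
    (hXL : ∀ y ∈ V, LinearIndependent ℝ (fun i => X i y) ∧
      Submodule.span ℝ (range fun i => X i y) = L y) :
    ∃ (W : Set E) (F : E → E →L[ℝ] E), IsOpen W ∧ y₀ ∈ W ∧ W ⊆ V ∧ ContDiffOn ℝ ∞ F W ∧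
      ∀ y ∈ W, (∀ a, F y a ∈ L y) ∧ (∀ l ∈ L y, F y l = l) ∧
        F y ∘L F y₀ = F y ∧ F y₀ ∘L F y = F y₀ := by
  let M : E → (Fin d → ℝ) →L[ℝ] E := fun y => ∑ i, (ContinuousLinearMap.proj i).smulRight (X i y)
  have hM : ContDiffOn ℝ ∞ M V := ContDiffOn.sum fun i _ =>
    ((ContinuousLinearMap.smulRightL ℝ (Fin d → ℝ) E
      (ContinuousLinearMap.proj i)).contDiff).comp_contDiffOn (hX i)
  have hMa : ∀ y z, M y z = ∑ i, z i • X i y := fun y z => by simp [M]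
  have hML : ∀ y ∈ V, ∀ l, l ∈ L y ↔ ∃ z, M y z = l := fun y hy l => by
    rw [← (hXL y hy).2, Submodule.mem_span_range_iff_exists_fun]
    simp only [hMa]
  obtain ⟨c, hc⟩ : ∃ c : E →L[ℝ] (Fin d → ℝ), c ∘L M y₀ = 1 := by
    have h1 : LinearMap.ker (M y₀ : (Fin d → ℝ) →ₗ[ℝ] E) = ⊥ := by
      rw [LinearMap.ker_eq_bot']
      intro z hz
      have h2 := Fintype.linearIndependent_iff.1 (hXL y₀ hy₀).1 z ((hMa y₀ z).symm.trans hz)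
      exact funext h2
    obtain ⟨l, hl⟩ := LinearMap.exists_leftInverse_of_injective _ h1
    exact ⟨l.toContinuousLinearMap, ContinuousLinearMap.ext fun z => LinearMap.congr_fun hl z⟩
  let C : E → (Fin d → ℝ) →L[ℝ] (Fin d → ℝ) := fun y => c ∘L M y
  have hC : ContDiffOn ℝ ∞ C V := contDiffOn_const.clm_comp hM
  -- Since `C y₀ = 1`, `C y` is invertible near `y₀`, and there `M y (C y)⁻¹ c` is the projection
  -- onto `L y` along `ker c`.
  refine ⟨V ∩ C ⁻¹' {A | IsUnit A}, fun y => M y ∘L (Ring.inverse (C y) ∘L c),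
    hC.continuousOn.isOpen_inter_preimage hV Units.isOpen, ⟨hy₀, ?_⟩, inter_subset_left, ?_, ?_⟩
  · change IsUnit (C y₀)
    simp [C, hc]
  · refine (hM.mono inter_subset_left).clm_comp (ContDiffOn.clm_comp ?_ contDiffOn_const)
    intro y hy
    obtain ⟨u, hu⟩ := hy.2
    have h1 : ContDiffAt ℝ ∞ Ring.inverse (C y) := hu ▸ contDiffAt_ringInverse ℝ u
    exact h1.comp_contDiffWithinAt y (hC.mono inter_subset_left y hy)
  · rintro y ⟨hy, hu⟩
    have hi : Ring.inverse (C y) ∘L C y = 1 := Ring.inverse_mul_cancel _ hu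
    have hi' : C y ∘L Ring.inverse (C y) = 1 := Ring.mul_inverse_cancel _ hu
    have h0 : Ring.inverse (C y₀) = 1 := by simp [C, hc]
    refine ⟨fun a => (hML y hy _).2 ⟨_, rfl⟩, fun l hl => ?_, ?_, ?_⟩
    · obtain ⟨z, rfl⟩ := (hML y hy l).1 hl
      exact congrArg (M y) (DFunLike.congr_fun hi z)
    · ext a
      simp only [h0]
      exact congrArg (fun z => M y (Ring.inverse (C y) z)) (DFunLike.congr_fun hc (c a))
    · ext a
      simp only [h0]
      exact congrArg (M y₀) (DFunLike.congr_fun hi' (c a))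

/-- A function which is smooth near a point agrees near this point with a smooth function. -/
theorem exists_contDiff_eventuallyEq [FiniteDimensional ℝ E] {Y : Type*} [NormedAddCommGroup Y]
    [NormedSpace ℝ Y] {W : Set E} (hW : IsOpen W) {y₀ : E} (hy₀ : y₀ ∈ W) {f : E → Y}
    (hf : ContDiffOn ℝ ∞ f W) : ∃ g : E → Y, ContDiff ℝ ∞ g ∧ g =ᶠ[𝓝 y₀] f := by
  obtain ⟨ε, hε, hεW⟩ := Metric.isOpen_iff.1 hW y₀ hy₀
  let χ : ContDiffBump y₀ := ⟨ε / 4, ε / 2, by positivity, by linarith⟩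
  refine ⟨fun x => χ x • f x, contDiff_iff_contDiffAt.2 fun x => ?_, ?_⟩
  · by_cases hx : x ∈ tsupport χ
    · rw [χ.tsupport_eq, Metric.mem_closedBall] at hx
      have h1 : x ∈ W := hεW (hx.trans_lt (show ε / 2 < ε by linarith))
      exact χ.contDiff.contDiffAt.smul (hf.contDiffAt (hW.mem_nhds h1))
    · refine contDiffAt_const (c := (0 : Y)) |>.congr_of_eventuallyEq ?_
      filter_upwards [notMem_tsupport_iff_eventuallyEq.1 hx] with z hz
      simp [hz]
  · filter_upwards [χ.eventuallyEq_one] with x hx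
    simp [hx]

/-- The projections onto an involutive distribution along a fixed complement commute. -/
theorem fderiv_projection_symm {L : E → Submodule ℝ E} {W : Set E} (hW : IsOpen W) {y₀ : E}
    {F : E → E →L[ℝ] E} (hF : ContDiffOn ℝ ∞ F W)
    (hFL : ∀ y ∈ W, (∀ a, F y a ∈ L y) ∧ (∀ l ∈ L y, F y l = l) ∧
      F y ∘L F y₀ = F y ∧ F y₀ ∘L F y = F y₀)
    (hinv : ∀ X Y : E → E, ContDiffOn ℝ ∞ X W → ContDiffOn ℝ ∞ Y W → (∀ y ∈ W, X y ∈ L y) →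
      (∀ y ∈ W, Y y ∈ L y) → ∀ y ∈ W, VectorField.lieBracket ℝ X Y y ∈ L y)
    {y : E} (hy : y ∈ W) (a b : E) : fderiv ℝ F y (F y a) b = fderiv ℝ F y (F y b) a := by
  have hd : HasFDerivAt F (fderiv ℝ F y) y :=
    ((hF.contDiffAt (hW.mem_nhds hy)).differentiableAt (by simp)).hasFDerivAt
  have hda : ∀ a, HasFDerivAt (fun y => F y a) ((fderiv ℝ F y).flip a) y := fun a => by
    convert! hd.clm_apply (hasFDerivAt_const a y) using 1
    ext v
    simp
  have h1 := hinv (fun y => F y b) (fun y => F y a) (hF.clm_apply contDiffOn_const)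
    (hF.clm_apply contDiffOn_const) (fun y hy => (hFL y hy).1 b) (fun y hy => (hFL y hy).1 a) y hy
  rw [VectorField.lieBracket, (hda a).fderiv, (hda b).fderiv] at h1
  change fderiv ℝ F y (F y b) a - fderiv ℝ F y (F y a) b ∈ L y at h1
  -- `F y₀ (F z c) = F y₀ c` is constant in `z`. So `F y₀` kills the bracket, and `F y = F y ∘ F y₀`
  -- kills it too while fixing `L y`.
  have hR : ∀ v c, F y₀ (fderiv ℝ F y v c) = 0 := fun v c => by
    have h2 := (F y₀).hasFDerivAt.comp y (hda c)
    have h3 : (F y₀ ∘ fun y => F y c) =ᶠ[𝓝 y] fun _ => F y₀ c :=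
      Filter.mem_of_superset (hW.mem_nhds hy) fun z hz => DFunLike.congr_fun (hFL z hz).2.2.2 c
    exact DFunLike.congr_fun (h2.unique ((hasFDerivAt_const _ _).congr_of_eventuallyEq h3)) v
  have h4 := (hFL y hy).2.1 _ h1
  have h5 := DFunLike.congr_fun (hFL y hy).2.2.1
    (fderiv ℝ F y (F y b) a - fderiv ℝ F y (F y a) b)
  rw [ContinuousLinearMap.comp_apply, map_sub (F y₀), hR, hR, sub_zero, map_zero, h4] at h5
  exact (sub_eq_zero.1 h5.symm).symm

variable {T : Type*} [NormedAddCommGroup T] [NormedSpace ℝ T]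

/-- The pullback of a form on a vector space under a map. -/
def pullbackForm {k : ℕ} (f : E → E) (η : E → E [⋀^Fin k]→L[ℝ] T) (x : E) : E [⋀^Fin k]→L[ℝ] T :=
  (η (f x)).compContinuousLinearMap (fderiv ℝ f x)

theorem extDeriv_pullbackForm {k : ℕ} {f : E → E} {η : E → E [⋀^Fin k]→L[ℝ] T} {x : E}
    (hη : ContDiffAt ℝ ∞ η (f x)) (hf : ContDiffAt ℝ ∞ f x) :
    extDeriv (pullbackForm f η) x = pullbackForm f (extDeriv η) x :=
  extDeriv_pullback (r := 2) (hη.differentiableAt (by simp))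
    (hf.of_le ENat.LEInfty.out) (by simp)

variable [FiniteDimensional ℝ E] [FiniteDimensional ℝ T] {k : ℕ}

theorem contDiffOn_pullbackForm {f : E → E} {η : E → E [⋀^Fin k]→L[ℝ] T} {s t : Set E}
    (hs : IsOpen s) (hη : ContDiffOn ℝ ∞ η t) (hf : ContDiffOn ℝ ∞ f s) (hst : MapsTo f s t) :
    ContDiffOn ℝ ∞ (pullbackForm f η) s :=
  (contDiff_compContinuousLinearMap k).comp_contDiffOn
    ((hη.comp hf hst).prodMk (hf.fderiv_of_isOpen hs (by simp)))

/-- The Poincaré lemma for horizontal forms on an open subset of a vector space. -/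
theorem exists_horizontal_primitive {V : Set E} (hV : IsOpen V) {y₀ : E} (hy₀ : y₀ ∈ V)
    {L : E → Submodule ℝ E} {d : ℕ} {X : Fin d → E → E} (hX : ∀ i, ContDiffOn ℝ ∞ (X i) V)
    (hXL : ∀ y ∈ V, LinearIndependent ℝ (fun i => X i y) ∧
      Submodule.span ℝ (range fun i => X i y) = L y)
    (hinv : ∀ W ⊆ V, IsOpen W → ∀ X Y : E → E, ContDiffOn ℝ ∞ X W → ContDiffOn ℝ ∞ Y W →
      (∀ y ∈ W, X y ∈ L y) → (∀ y ∈ W, Y y ∈ L y) →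
      ∀ y ∈ W, VectorField.lieBracket ℝ X Y y ∈ L y)
    {η : E → E [⋀^Fin (k + 1)]→L[ℝ] T} (hη : ContDiffOn ℝ ∞ η V)
    (hd : ∀ y ∈ V, extDeriv η y = 0) {r : ℕ} (hr : 1 ≤ r)
    (hhor : ∀ y ∈ V, ContractionsVanish (L y) (r + 1) (k + 1) (η y).toAlternatingMap) :
    ∃ (U : Set E) (θ : E → E [⋀^Fin k]→L[ℝ] T), IsOpen U ∧ y₀ ∈ U ∧ U ⊆ V ∧
      ContDiffOn ℝ ∞ θ U ∧ (∀ y ∈ U, ContractionsVanish (L y) r k (θ y).toAlternatingMap) ∧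
      ∀ y ∈ U, extDeriv θ y = η y := by
  obtain ⟨W, F, hW, hy₀W, hWV, hF, hFL⟩ := exists_projection_onto hV hy₀ hX hXL
  have hsymm : ∀ y ∈ W, _ := fun y hy => fderiv_projection_symm hW hF hFL (hinv W hWV hW) hy
  -- The straightening requires a globally smooth family; near `y₀` it agrees with `F`.
  obtain ⟨G, hG, hGF⟩ := exists_contDiff_eventuallyEq hW hy₀W hF
  obtain ⟨W', hW'GF, hW', hy₀W'⟩ := eventually_nhds_iff.1 (hGF.and (hW.mem_nhds hy₀W))
  have hsymmG : ∀ᶠ y in 𝓝 y₀, ∀ a b, fderiv ℝ G y (G y a) b = fderiv ℝ G y (G y b) a := by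
    filter_upwards [hGF.eventuallyEq_nhds, hW.mem_nhds hy₀W] with y hy hyW a b
    rw [hy.fderiv_eq, hy.eq_of_nhds]
    exact hsymm y hyW a b
  set R := F y₀ with hRdef
  obtain ⟨hR1, -, hRR, -⟩ := hFL y₀ hy₀W
  have hRR' : ∀ v, R (R v) = R v := fun v => DFunLike.congr_fun hRR v
  obtain ⟨N, Φ, hN, h0N, hΦ, hΦ0, hΦ1, hΦG⟩ := exists_straightening hG (Q := 1 - R) (R := R)
    (by simp) (y₀ := y₀) hGF.eq_of_nhds hsymmG
  obtain ⟨e, he0, hes, heΦ, hesymm⟩ := exists_openPartialHomeomorph_contDiffOn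
    (hΦ.continuousOn.isOpen_inter_preimage hN hW') (a := 0) ⟨h0N, by simpa [hΦ0] using hy₀W'⟩
    (hΦ.mono inter_subset_left) (.refl ℝ E) hΦ1
  have hsrc : ∀ x ∈ e.source, x ∈ N ∧ Φ x ∈ W ∧ G (Φ x) = F (Φ x) := fun x hx =>
    ⟨(hes hx).1, (hW'GF _ (hes hx).2).2, (hW'GF _ (hes hx).2).1⟩
  have hΦe : ContDiffOn ℝ ∞ Φ e.source := hΦ.mono fun x hx => (hsrc x hx).1
  have hΦat : ∀ x ∈ e.source, ContDiffAt ℝ ∞ Φ x := fun x hx =>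
    hΦe.contDiffAt (e.open_source.mem_nhds hx)
  have hΨat : ∀ y ∈ e.target, ContDiffAt ℝ ∞ e.symm y := fun y hy =>
    hesymm.contDiffAt (e.open_target.mem_nhds hy)
  have hDΨΦ : ∀ x ∈ e.source, ∀ v, fderiv ℝ e.symm (Φ x) (fderiv ℝ Φ x v) = v := fun x hx v => by
    have h0 : Φ x ∈ e.target := heΦ ▸ e.map_source hx
    have h1 := ((hΨat _ h0).differentiableAt (by simp)).hasFDerivAt.comp x
      ((hΦat x hx).differentiableAt (by simp)).hasFDerivAt
    have h2 : e.symm ∘ Φ =ᶠ[𝓝 x] id := by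
      filter_upwards [e.open_source.mem_nhds hx] with z hz
      rw [← heΦ]
      exact e.left_inv hz
    exact DFunLike.congr_fun (h1.unique ((hasFDerivAt_id x).congr_of_eventuallyEq h2)) v
  have hDΦΨ : ∀ y ∈ e.target, ∀ v, fderiv ℝ Φ (e.symm y) (fderiv ℝ e.symm y v) = v :=
      fun y hy v => by
    have h1 := ((hΦat _ (e.map_target hy)).differentiableAt (by simp)).hasFDerivAt.comp y
      ((hΨat y hy).differentiableAt (by simp)).hasFDerivAt
    have h2 : Φ ∘ e.symm =ᶠ[𝓝 y] id := by
      filter_upwards [e.open_target.mem_nhds hy] with z hz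
      rw [← heΦ]
      exact e.right_inv hz
    exact DFunLike.congr_fun (h1.unique ((hasFDerivAt_id y).congr_of_eventuallyEq h2)) v
  have hDΦR : ∀ x ∈ e.source, ∀ v, fderiv ℝ Φ x (R v) = F (Φ x) (R v) := fun x hx v => by
    rw [hΦG x (hsrc x hx).1 (R v) (by simp [hRR']), (hsrc x hx).2.2]
  obtain ⟨ζ, hζ, hζη⟩ := exists_contDiff_eventuallyEq e.open_source he0
    (contDiffOn_pullbackForm e.open_source hη hΦe fun x hx => hWV (hsrc x hx).2.1)
  obtain ⟨ε, hε, hεζ⟩ := Metric.eventually_nhds_iff.1 (hζη.and (e.open_source.mem_nhds he0))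
  -- A product of balls, unlike a ball of `E` in general, is stable under shrinking the two
  -- components independently. The halves put it inside the `ε`-ball.
  let U₀ : Set E := {x | ‖(1 - R) x‖ < ε / 2 ∧ ‖R x‖ < ε / 2}
  have hU₀o : IsOpen U₀ :=
    (isOpen_lt (1 - R).continuous.norm continuous_const).inter
      (isOpen_lt R.continuous.norm continuous_const)
  have hU₀ : ∀ x ∈ U₀, ζ x = pullbackForm Φ η x ∧ x ∈ e.source := fun x hx => by
    refine hεζ ?_
    have h1 : x = (1 - R) x + R x := by simp
    rw [dist_zero_right, h1]
    linarith [norm_add_le ((1 - R) x) (R x), hx.1, hx.2]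
  have hζd : ∀ x ∈ U₀, extDeriv ζ x = 0 := fun x hx => by
    have h1 : ζ =ᶠ[𝓝 x] pullbackForm Φ η :=
      Filter.mem_of_superset (hU₀o.mem_nhds hx) fun z hz => (hU₀ z hz).1
    have h2 := hWV (hsrc x (hU₀ x hx).2).2.1
    rw [h1.extDeriv_eq, extDeriv_pullbackForm (hη.contDiffAt (hV.mem_nhds h2))
      (hΦat x (hU₀ x hx).2), pullbackForm, hd _ h2]
    rfl
  have hζhor : ∀ x ∈ U₀, ContractionsVanish R.range (r + 1) (k + 1) (ζ x).toAlternatingMap := by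
    intro x hx
    obtain ⟨h1, h2⟩ := hU₀ x hx
    rw [h1]
    refine (hhor _ (hWV (hsrc x h2).2.1)).comp _ ?_
    rintro _ ⟨v, rfl⟩
    exact hDΦR x h2 v ▸ (hFL _ (hsrc x h2).2.1).1 _
  obtain ⟨θ, hθ, hθhor, hθd⟩ := exists_primitive_of_linear (Q := 1 - R) (R := R) (by simp) hRR
    (U := U₀) (by
      rintro x ⟨hx1, hx2⟩ s hs t ht
      have h1 : (1 - R) (s • (1 - R) x + t • R x) = s • (1 - R) x := by
        simp [hRR']
      have h2 : R (s • (1 - R) x + t • R x) = t • R x := by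
        simp [hRR']
      refine ⟨?_, ?_⟩
      · rw [h1, norm_smul, Real.norm_of_nonneg hs.1]
        exact (mul_le_of_le_one_left (norm_nonneg _) hs.2).trans_lt hx1
      · rw [h2, norm_smul, Real.norm_of_nonneg ht.1]
        exact (mul_le_of_le_one_left (norm_nonneg _) ht.2).trans_lt hx2)
    hζ hζd hr hζhor
  refine ⟨e.target ∩ e.symm ⁻¹' U₀, pullbackForm e.symm θ,
    hesymm.continuousOn.isOpen_inter_preimage e.open_target hU₀o, ?_, ?_, ?_, ?_, ?_⟩
  · have h1 : e 0 = y₀ := by rw [heΦ, hΦ0]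
    rw [← h1]
    refine ⟨e.map_source he0, ?_⟩
    rw [mem_preimage, e.left_inv he0]
    simp [U₀, hε]
  · rintro y ⟨hy, -⟩
    have h1 := (hsrc _ (e.map_target hy)).2.1
    rw [← heΦ, e.right_inv hy] at h1
    exact hWV h1
  · exact (contDiffOn_pullbackForm e.open_target hθ.contDiffOn hesymm (mapsTo_univ _ _)).mono
      inter_subset_left
  · rintro y ⟨hy, hyU⟩
    -- For `l ∈ L y`, `l = F y l = F y (R l) = DΦ (R l)`, so the derivative of the inverse sends `l`
    -- to `R l`.
    refine (hθhor _ hyU).comp _ fun l hl => ⟨l, ?_⟩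
    have h0 := e.map_target hy
    have h1 : Φ (e.symm y) = y := by rw [← heΦ, e.right_inv hy]
    have h2 := hsrc _ h0
    have h3 := hDΨΦ _ h0 (R l)
    have h4 := hFL _ h2.2.1
    rw [hDΦR _ h0, h1] at h3
    rw [h1] at h4
    refine h3.symm.trans (congrArg _ ?_)
    exact (h4.2.1 l hl).symm.trans (DFunLike.congr_fun h4.2.2.1 l).symm |>.symm
  · rintro y ⟨hy, hyU⟩
    rw [extDeriv_pullbackForm hθ.contDiffAt (hΨat y hy), pullbackForm, hθd _ hyU, (hU₀ _ hyU).1]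
    ext v
    have h1 : Φ (e.symm y) = y := by rw [← heΦ, e.right_inv hy]
    change η (Φ (e.symm y)) (fun i => fderiv ℝ Φ (e.symm y) (fderiv ℝ e.symm y (v i))) = η y v
    simp only [hDΦΨ y hy, h1]

end Flat

/-! ### Forms, vector fields and distributions in charts -/

section Transfer

variable {E : Type*} [NormedAddCommGroup E] [NormedSpace ℝ E]
  {P : Type*} [TopologicalSpace P] [ChartedSpace E P]
  {T : Type*} [NormedAddCommGroup T] [NormedSpace ℝ T]

/-- The derivative of the preferred chart at `x`, as an endomorphism of the model space. -/
def chartDeriv (x p : P) : E →L[ℝ] E :=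
  mfderiv 𝓘(ℝ, E) 𝓘(ℝ, E) (extChartAt 𝓘(ℝ, E) x) p

/-- The derivative of the inverse of the preferred chart at `x`, as an endomorphism of the model
space. -/
def chartSymmDeriv (x : P) (y : E) : E →L[ℝ] E :=
  mfderiv 𝓘(ℝ, E) 𝓘(ℝ, E) (extChartAt 𝓘(ℝ, E) x).symm y

/-- A differential form, viewed as a function with values in the forms on the model space. -/
def DiffForm.toModel {k : ℕ} (η : DiffForm E P T k) (p : P) : E [⋀^Fin k]→L[ℝ] T := η p

theorem DiffForm.inChart_apply {k : ℕ} (η : DiffForm E P T k) (x : P) (y : E) :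
    η.inChart x y = (η.toModel ((extChartAt 𝓘(ℝ, E) x).symm y)).compContinuousLinearMap
      (chartSymmDeriv x y) := rfl

theorem DiffForm.toModel_d {k : ℕ} (η : DiffForm E P T k) (p : P) :
    η.d.toModel p = (extDeriv (η.inChart p) (extChartAt 𝓘(ℝ, E) p p)).compContinuousLinearMap
      (chartDeriv p p) := rfl

variable [IsManifold 𝓘(ℝ, E) ∞ P]

theorem chartDeriv_comp_chartSymmDeriv {x : P} {y : E} (hy : y ∈ (extChartAt 𝓘(ℝ, E) x).target) :
    (chartDeriv x ((extChartAt 𝓘(ℝ, E) x).symm y)).comp (chartSymmDeriv x y) =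
      ContinuousLinearMap.id ℝ E := by
  have : IsManifold 𝓘(ℝ, E) 1 P := IsManifold.of_le (n := ∞) (by simp)
  have h := mfderiv_extChartAt_comp_mfderivWithin_extChartAt_symm (I := 𝓘(ℝ, E)) hy
  rw [ModelWithCorners.Boundaryless.range_eq_univ, mfderivWithin_univ] at h
  exact h

theorem chartSymmDeriv_comp_chartDeriv {x p : P} (hp : p ∈ (extChartAt 𝓘(ℝ, E) x).source) :
    (chartSymmDeriv x (extChartAt 𝓘(ℝ, E) x p)).comp (chartDeriv x p) =
      ContinuousLinearMap.id ℝ E := by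
  have : IsManifold 𝓘(ℝ, E) 1 P := IsManifold.of_le (n := ∞) (by simp)
  have h := mfderivWithin_extChartAt_symm_comp_mfderiv_extChartAt' (I := 𝓘(ℝ, E)) hp
  rw [ModelWithCorners.Boundaryless.range_eq_univ, mfderivWithin_univ] at h
  exact h

theorem chartDeriv_comp_chartSymmDeriv' {x p : P} (hp : p ∈ (extChartAt 𝓘(ℝ, E) x).source) :
    (chartDeriv x p).comp (chartSymmDeriv x (extChartAt 𝓘(ℝ, E) x p)) =
      ContinuousLinearMap.id ℝ E := by
  have h := chartDeriv_comp_chartSymmDeriv ((extChartAt 𝓘(ℝ, E) x).map_source hp)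
  rwa [(extChartAt 𝓘(ℝ, E) x).left_inv hp] at h

theorem chartSymmDeriv_comp_chartDeriv' {x : P} {y : E} (hy : y ∈ (extChartAt 𝓘(ℝ, E) x).target) :
    (chartSymmDeriv x y).comp (chartDeriv x ((extChartAt 𝓘(ℝ, E) x).symm y)) =
      ContinuousLinearMap.id ℝ E := by
  have h := chartSymmDeriv_comp_chartDeriv ((extChartAt 𝓘(ℝ, E) x).map_target hy)
  rwa [(extChartAt 𝓘(ℝ, E) x).right_inv hy] at h

theorem contMDiffAt_chart {x p : P} (hp : p ∈ (extChartAt 𝓘(ℝ, E) x).source) :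
    ContMDiffAt 𝓘(ℝ, E) 𝓘(ℝ, E) ∞ (extChartAt 𝓘(ℝ, E) x) p :=
  contMDiffAt_extChartAt' (by rwa [extChartAt_source] at hp)

theorem contMDiffAt_chart_symm {x : P} {y : E} (hy : y ∈ (extChartAt 𝓘(ℝ, E) x).target) :
    ContMDiffAt 𝓘(ℝ, E) 𝓘(ℝ, E) ∞ (extChartAt 𝓘(ℝ, E) x).symm y :=
  (contMDiffOn_extChartAt_symm x).contMDiffAt ((isOpen_extChartAt_target x).mem_nhds hy)

theorem contDiffAt_transition {x x' : P} {y : E} (hy : y ∈ (extChartAt 𝓘(ℝ, E) x').target)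
    (hy' : (extChartAt 𝓘(ℝ, E) x').symm y ∈ (extChartAt 𝓘(ℝ, E) x).source) :
    ContDiffAt ℝ ∞ (extChartAt 𝓘(ℝ, E) x ∘ (extChartAt 𝓘(ℝ, E) x').symm) y :=
  ((contMDiffAt_chart hy').comp y (contMDiffAt_chart_symm hy)).contDiffAt

theorem fderiv_transition {x x' : P} {y : E} (hy : y ∈ (extChartAt 𝓘(ℝ, E) x').target)
    (hy' : (extChartAt 𝓘(ℝ, E) x').symm y ∈ (extChartAt 𝓘(ℝ, E) x).source) :
    fderiv ℝ (extChartAt 𝓘(ℝ, E) x ∘ (extChartAt 𝓘(ℝ, E) x').symm) y =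
      (chartDeriv x ((extChartAt 𝓘(ℝ, E) x').symm y)).comp (chartSymmDeriv x' y) := by
  rw [← mfderiv_eq_fderiv]
  exact mfderiv_comp y ((contMDiffAt_chart hy').mdifferentiableAt (by simp))
    ((contMDiffAt_chart_symm hy).mdifferentiableAt (by simp))

theorem pullbackForm_transition {k : ℕ} {x x' : P} {y : E}
    (hy : y ∈ (extChartAt 𝓘(ℝ, E) x').target)
    (hy' : (extChartAt 𝓘(ℝ, E) x').symm y ∈ (extChartAt 𝓘(ℝ, E) x).source)
    (ζ : E → E [⋀^Fin k]→L[ℝ] T) :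
    pullbackForm (extChartAt 𝓘(ℝ, E) x ∘ (extChartAt 𝓘(ℝ, E) x').symm) ζ y =
      ((ζ (extChartAt 𝓘(ℝ, E) x ((extChartAt 𝓘(ℝ, E) x').symm y))).compContinuousLinearMap
        (chartDeriv x ((extChartAt 𝓘(ℝ, E) x').symm y))).compContinuousLinearMap
        (chartSymmDeriv x' y) := by
  rw [pullbackForm, fderiv_transition hy hy']
  rfl

theorem DiffForm.toModel_eq_inChart {k : ℕ} (η : DiffForm E P T k) {x p : P}
    (hp : p ∈ (extChartAt 𝓘(ℝ, E) x).source) :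
    η.toModel p = (η.inChart x (extChartAt 𝓘(ℝ, E) x p)).compContinuousLinearMap
      (chartDeriv x p) := by
  rw [η.inChart_apply, (extChartAt 𝓘(ℝ, E) x).left_inv hp]
  ext v
  have h := chartSymmDeriv_comp_chartDeriv hp
  refine congrArg (η.toModel p) (funext fun i => ?_)
  exact (DFunLike.congr_fun h (v i)).symm

theorem DiffForm.inChart_eq_pullbackForm {k : ℕ} (η : DiffForm E P T k) {x x' : P} {y : E}
    (hy : y ∈ (extChartAt 𝓘(ℝ, E) x').target)
    (hy' : (extChartAt 𝓘(ℝ, E) x').symm y ∈ (extChartAt 𝓘(ℝ, E) x).source) :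
    η.inChart x' y =
      pullbackForm (extChartAt 𝓘(ℝ, E) x ∘ (extChartAt 𝓘(ℝ, E) x').symm) (η.inChart x) y := by
  rw [pullbackForm_transition hy hy', ← η.toModel_eq_inChart hy', η.inChart_apply]

theorem eventually_mem_transition {x' : P} {y : E}
    (hy : y ∈ (extChartAt 𝓘(ℝ, E) x').target) {U : Set P} (hU : IsOpen U)
    (hy' : (extChartAt 𝓘(ℝ, E) x').symm y ∈ U) :
    ∀ᶠ z in 𝓝 y, z ∈ (extChartAt 𝓘(ℝ, E) x').target ∧ (extChartAt 𝓘(ℝ, E) x').symm z ∈ U :=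
  Filter.Eventually.and ((isOpen_extChartAt_target x').mem_nhds hy)
    ((contMDiffAt_chart_symm hy).continuousAt.eventually (hU.mem_nhds hy'))

/-- The exterior derivative can be computed in any chart. -/
theorem DiffForm.toModel_d_eq {k : ℕ} (η : DiffForm E P T k) {x p : P}
    (hp : p ∈ (extChartAt 𝓘(ℝ, E) x).source)
    (hη : ContDiffAt ℝ ∞ (η.inChart x) (extChartAt 𝓘(ℝ, E) x p)) :
    η.d.toModel p = (extDeriv (η.inChart x) (extChartAt 𝓘(ℝ, E) x p)).compContinuousLinearMap
      (chartDeriv x p) := by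
  have hs := mem_extChartAt_source (I := 𝓘(ℝ, E)) p
  have ht := mem_extChartAt_target (I := 𝓘(ℝ, E)) p
  have hinv := extChartAt_to_inv (I := 𝓘(ℝ, E)) p
  have hp' : (extChartAt 𝓘(ℝ, E) p).symm (extChartAt 𝓘(ℝ, E) p p) ∈
      (extChartAt 𝓘(ℝ, E) x).source := by rwa [hinv]
  have hev : η.inChart p =ᶠ[𝓝 (extChartAt 𝓘(ℝ, E) p p)]
      pullbackForm (extChartAt 𝓘(ℝ, E) x ∘ (extChartAt 𝓘(ℝ, E) p).symm) (η.inChart x) := by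
    filter_upwards [eventually_mem_transition ht (isOpen_extChartAt_source x) hp']
      with z hz using η.inChart_eq_pullbackForm hz.1 hz.2
  -- `extDeriv` commutes with pullback under the transition map; the derivatives of the chart at `p`
  -- and of its inverse then cancel.
  rw [η.toModel_d, hev.extDeriv_eq,
    extDeriv_pullbackForm (by simpa only [Function.comp_apply, hinv] using hη)
      (contDiffAt_transition ht hp'), pullbackForm_transition ht hp', hinv]
  ext v
  refine congrArg (extDeriv (η.inChart x) (extChartAt 𝓘(ℝ, E) x p)) (funext fun i => ?_)
  exact congrArg (chartDeriv x p) (DFunLike.congr_fun (chartSymmDeriv_comp_chartDeriv hs) (v i))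

theorem DiffForm.extDeriv_inChart_eq_zero {k : ℕ} {η : DiffForm E P T k} (hη : η.SmoothOn univ)
    (hd : ∀ p, η.d p = 0) (x : P) {y : E} (hy : y ∈ (extChartAt 𝓘(ℝ, E) x).target) :
    extDeriv (η.inChart x) y = 0 := by
  have hyt := (isOpen_extChartAt_target (I := 𝓘(ℝ, E)) x).mem_nhds hy
  have h := η.toModel_d_eq (x := x) ((extChartAt 𝓘(ℝ, E) x).map_target hy) (by
    rw [(extChartAt 𝓘(ℝ, E) x).right_inv hy]
    have hx := hη x
    rw [preimage_univ, inter_univ] at hx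
    exact hx.contDiffAt hyt)
  rw [(extChartAt 𝓘(ℝ, E) x).right_inv hy] at h
  ext v
  have hv := DFunLike.congr_fun h fun i => chartSymmDeriv x y (v i)
  have hz : η.d.toModel ((extChartAt 𝓘(ℝ, E) x).symm y) = 0 := hd _
  rw [hz] at hv
  refine Eq.trans (congrArg (extDeriv (η.inChart x) y) (funext fun i => ?_)) hv.symm
  exact (DFunLike.congr_fun (chartDeriv_comp_chartSymmDeriv hy) (v i)).symm

theorem isInvertible_chartSymmDeriv {x : P} {y : E} (hy : y ∈ (extChartAt 𝓘(ℝ, E) x).target) :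
    (mfderiv 𝓘(ℝ, E) 𝓘(ℝ, E) (extChartAt 𝓘(ℝ, E) x).symm y).IsInvertible := by
  have : IsManifold 𝓘(ℝ, E) 1 P := IsManifold.of_le (n := ∞) (by simp)
  have h := isInvertible_mfderivWithin_extChartAt_symm (I := 𝓘(ℝ, E)) hy
  rwa [ModelWithCorners.Boundaryless.range_eq_univ, mfderivWithin_univ] at h

theorem isInvertible_chartDeriv {x p : P} (hp : p ∈ (extChartAt 𝓘(ℝ, E) x).source) :
    (mfderiv 𝓘(ℝ, E) 𝓘(ℝ, E) (extChartAt 𝓘(ℝ, E) x) p).IsInvertible := by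
  have : IsManifold 𝓘(ℝ, E) 1 P := IsManifold.of_le (n := ∞) (by simp)
  exact isInvertible_mfderiv_extChartAt hp

theorem inverse_chartSymmDeriv {x : P} {y : E} (hy : y ∈ (extChartAt 𝓘(ℝ, E) x).target) :
    (chartSymmDeriv x y).inverse = chartDeriv x ((extChartAt 𝓘(ℝ, E) x).symm y) :=
  ContinuousLinearMap.inverse_eq (chartSymmDeriv_comp_chartDeriv' hy)
    (chartDeriv_comp_chartSymmDeriv hy)

theorem inverse_chartDeriv {x p : P} (hp : p ∈ (extChartAt 𝓘(ℝ, E) x).source) :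
    (chartDeriv x p).inverse = chartSymmDeriv x (extChartAt 𝓘(ℝ, E) x p) :=
  ContinuousLinearMap.inverse_eq (chartDeriv_comp_chartSymmDeriv' hp)
    (chartSymmDeriv_comp_chartDeriv hp)

/-- A vector field, viewed as a function with values in the model space. -/
def fieldToModel (X : (p : P) → TangentSpace 𝓘(ℝ, E) p) (p : P) : E := X p

/-- The expression of a vector field in the preferred chart at `x`. -/
def fieldInChart (x : P) (X : (p : P) → TangentSpace 𝓘(ℝ, E) p) : E → E :=
  VectorField.mpullback 𝓘(ℝ, E) 𝓘(ℝ, E) (extChartAt 𝓘(ℝ, E) x).symm X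

/-- The vector field on the domain of the preferred chart at `x` with a given expression in this
chart. -/
def fieldOfChart (x : P) (X : E → E) : (p : P) → TangentSpace 𝓘(ℝ, E) p :=
  VectorField.mpullback 𝓘(ℝ, E) 𝓘(ℝ, E) (extChartAt 𝓘(ℝ, E) x) X

theorem fieldInChart_apply {x : P} {y : E} (hy : y ∈ (extChartAt 𝓘(ℝ, E) x).target)
    (X : (p : P) → TangentSpace 𝓘(ℝ, E) p) :
    fieldInChart x X y = chartDeriv x ((extChartAt 𝓘(ℝ, E) x).symm y)
      (fieldToModel X ((extChartAt 𝓘(ℝ, E) x).symm y)) := by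
  rw [← inverse_chartSymmDeriv hy]
  rfl

theorem fieldOfChart_apply {x p : P} (hp : p ∈ (extChartAt 𝓘(ℝ, E) x).source) (X : E → E) :
    fieldToModel (fieldOfChart x X) p =
      chartSymmDeriv x (extChartAt 𝓘(ℝ, E) x p) (X (extChartAt 𝓘(ℝ, E) x p)) := by
  rw [← inverse_chartDeriv hp]
  rfl

theorem contDiffOn_fieldInChart [FiniteDimensional ℝ E] (x : P)
    {X : (p : P) → TangentSpace 𝓘(ℝ, E) p} {U : Set P} (hU : IsOpen U) (hX : SmoothFieldOn X U) :
    ContDiffOn ℝ ∞ (fieldInChart x X)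
      ((extChartAt 𝓘(ℝ, E) x).target ∩ (extChartAt 𝓘(ℝ, E) x).symm ⁻¹' U) := by
  have : CompleteSpace E := FiniteDimensional.complete ℝ E
  rintro y ⟨hy, hyU⟩
  refine (contMDiffAt_vectorSpace_iff_contDiffAt.1 ?_).contDiffWithinAt
  exact ContMDiffAt.mpullback_vectorField_preimage (hX.contMDiffAt (hU.mem_nhds hyU))
    (contMDiffAt_chart_symm hy)
    (isInvertible_chartSymmDeriv hy) (by simp)

theorem smoothFieldOn_fieldOfChart [FiniteDimensional ℝ E] (x : P) {X : E → E} {W : Set E}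
    (hW : IsOpen W) (hX : ContDiffOn ℝ ∞ X W) :
    SmoothFieldOn (fieldOfChart x X)
      ((extChartAt 𝓘(ℝ, E) x).source ∩ extChartAt 𝓘(ℝ, E) x ⁻¹' W) := by
  have : CompleteSpace E := FiniteDimensional.complete ℝ E
  rintro p ⟨hp, hpW⟩
  refine ContMDiffAt.contMDiffWithinAt ?_
  exact ContMDiffAt.mpullback_vectorField_preimage
    (contMDiffAt_vectorSpace_iff_contDiffAt.2 (hX.contDiffAt (hW.mem_nhds hpW)))
    (contMDiffAt_chart hp)
    (isInvertible_chartDeriv hp) (by simp)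

/-- Naturality of the Lie bracket under the chart, which transports involutivity to the model space.
-/
theorem mlieBracket_fieldOfChart [FiniteDimensional ℝ E] {x p : P}
    (hp : p ∈ (extChartAt 𝓘(ℝ, E) x).source) {X Y : E → E}
    (hX : ContDiffAt ℝ ∞ X (extChartAt 𝓘(ℝ, E) x p))
    (hY : ContDiffAt ℝ ∞ Y (extChartAt 𝓘(ℝ, E) x p)) :
    fieldToModel (VectorField.mlieBracket 𝓘(ℝ, E) (fieldOfChart x X) (fieldOfChart x Y)) p =
      chartSymmDeriv x (extChartAt 𝓘(ℝ, E) x p)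
        (VectorField.lieBracket ℝ X Y (extChartAt 𝓘(ℝ, E) x p)) := by
  have : CompleteSpace E := FiniteDimensional.complete ℝ E
  have : IsManifold 𝓘(ℝ, E) (minSmoothness ℝ 3) P :=
    IsManifold.of_le (n := ∞) (by simpa using ENat.LEInfty.out)
  have h := VectorField.mpullback_mlieBracket (n := ∞) (I := 𝓘(ℝ, E)) (I' := 𝓘(ℝ, E))
    ((contMDiffAt_vectorSpace_iff_contDiffAt.2 hX).mdifferentiableAt (by simp))
    ((contMDiffAt_vectorSpace_iff_contDiffAt.2 hY).mdifferentiableAt (by simp))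
    (contMDiffAt_chart hp) (by simpa using ENat.LEInfty.out)
  have he : VectorField.mlieBracket 𝓘(ℝ, E) X Y = VectorField.lieBracket ℝ X Y := by
    rw [← VectorField.lieBracketWithin_univ]
    exact VectorField.mlieBracketWithin_eq_lieBracketWithin (s := univ)
  have hf := fieldOfChart_apply hp (VectorField.mlieBracket 𝓘(ℝ, E) X Y)
  rw [he] at hf
  exact (h.symm.trans (congrArg
    (fun Z : E → E => fieldToModel (E := E) (P := P) (fieldOfChart x Z) p) he)).trans hf

/-- A family of subspaces of the tangent spaces, viewed as a family of subspaces of the model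
space. -/
def distribToModel (L : (p : P) → Submodule ℝ (TangentSpace 𝓘(ℝ, E) p)) (p : P) :
    Submodule ℝ E := L p

/-- The expression of a family of subspaces of the tangent spaces in the preferred chart at `x`. -/
def distribInChart (x : P) (L : (p : P) → Submodule ℝ (TangentSpace 𝓘(ℝ, E) p)) (y : E) :
    Submodule ℝ E :=
  (distribToModel L ((extChartAt 𝓘(ℝ, E) x).symm y)).comap (chartSymmDeriv x y : E →ₗ[ℝ] E)

variable {L : (p : P) → Submodule ℝ (TangentSpace 𝓘(ℝ, E) p)}

omit [IsManifold 𝓘(ℝ, E) ∞ P] in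
theorem mem_distribInChart {x : P} {y v : E} :
    v ∈ distribInChart x L y ↔
      chartSymmDeriv x y v ∈ distribToModel L ((extChartAt 𝓘(ℝ, E) x).symm y) := Iff.rfl

theorem chartDeriv_mem_distribInChart {x p : P} (hp : p ∈ (extChartAt 𝓘(ℝ, E) x).source)
    {v : E} (hv : v ∈ distribToModel L p) :
    chartDeriv x p v ∈ distribInChart x L (extChartAt 𝓘(ℝ, E) x p) := by
  have h : chartSymmDeriv x (extChartAt 𝓘(ℝ, E) x p) (chartDeriv x p v) = v :=
    DFunLike.congr_fun (chartSymmDeriv_comp_chartDeriv hp) v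
  rwa [mem_distribInChart, h, (extChartAt 𝓘(ℝ, E) x).left_inv hp]

theorem distribInChart_eq_map {x : P} {y : E} (hy : y ∈ (extChartAt 𝓘(ℝ, E) x).target) :
    distribInChart x L y = (distribToModel L ((extChartAt 𝓘(ℝ, E) x).symm y)).map
      (chartDeriv (E := E) x ((extChartAt 𝓘(ℝ, E) x).symm y) : E →ₗ[ℝ] E) := by
  ext v
  rw [mem_distribInChart, Submodule.mem_map]
  constructor
  · exact fun h => ⟨_, h, DFunLike.congr_fun (chartDeriv_comp_chartSymmDeriv hy) v⟩
  · rintro ⟨w, hw, rfl⟩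
    have h : chartSymmDeriv x y (chartDeriv x ((extChartAt 𝓘(ℝ, E) x).symm y) w) = w :=
      DFunLike.congr_fun (chartSymmDeriv_comp_chartDeriv' hy) w
    exact h.symm ▸ hw

/-- The expression of a local frame of a distribution in a chart is a local frame. -/
theorem frame_fieldInChart {x : P} {y : E} (hy : y ∈ (extChartAt 𝓘(ℝ, E) x).target) {d : ℕ}
    {X : Fin d → (q : P) → TangentSpace 𝓘(ℝ, E) q}
    (hX : LinearIndependent ℝ (fun i => fieldToModel (X i) ((extChartAt 𝓘(ℝ, E) x).symm y)) ∧
      Submodule.span ℝ (range fun i => fieldToModel (X i) ((extChartAt 𝓘(ℝ, E) x).symm y)) =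
        distribToModel L ((extChartAt 𝓘(ℝ, E) x).symm y)) :
    LinearIndependent ℝ (fun i => fieldInChart x (X i) y) ∧
      Submodule.span ℝ (range fun i => fieldInChart x (X i) y) = distribInChart x L y := by
  set A : E →ₗ[ℝ] E := (chartDeriv (E := E) x ((extChartAt 𝓘(ℝ, E) x).symm y) : E →ₗ[ℝ] E) with hA
  have hA' : (fun i => fieldInChart x (X i) y) =
      A ∘ fun i => fieldToModel (X i) ((extChartAt 𝓘(ℝ, E) x).symm y) :=
    funext fun i => fieldInChart_apply hy (X i)
  rw [hA']
  constructor
  · refine hX.1.map' A (LinearMap.ker_eq_bot.2 ?_)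
    exact Function.LeftInverse.injective (g := chartSymmDeriv x y)
      fun v => DFunLike.congr_fun (chartSymmDeriv_comp_chartDeriv' hy) v
  · rw [distribInChart_eq_map hy, ← hX.2, Submodule.map_span, ← range_comp]

theorem IsInvolutive.distribInChart [FiniteDimensional ℝ E] (hL : IsInvolutive L) (x : P)
    {W : Set E} (hWt : W ⊆ (extChartAt 𝓘(ℝ, E) x).target) (hW : IsOpen W) {X Y : E → E}
    (hX : ContDiffOn ℝ ∞ X W) (hY : ContDiffOn ℝ ∞ Y W)
    (hXL : ∀ y ∈ W, X y ∈ distribInChart x L y) (hYL : ∀ y ∈ W, Y y ∈ distribInChart x L y)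
    {y : E} (hy : y ∈ W) :
    VectorField.lieBracket ℝ X Y y ∈ distribInChart x L y := by
  have aux : ∀ Z : E → E, (∀ y ∈ W, Z y ∈ PoincareHorizontal.distribInChart x L y) →
      ∀ p ∈ (extChartAt 𝓘(ℝ, E) x).source ∩ extChartAt 𝓘(ℝ, E) x ⁻¹' W,
        fieldOfChart x Z p ∈ L p := by
    rintro Z hZ p ⟨hp, hpW⟩
    have h := hZ _ hpW
    rw [mem_distribInChart, ← fieldOfChart_apply hp, (extChartAt 𝓘(ℝ, E) x).left_inv hp] at h
    exact h
  have hys := (extChartAt 𝓘(ℝ, E) x).map_target (hWt hy)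
  have hyr := (extChartAt 𝓘(ℝ, E) x).right_inv (hWt hy)
  -- Involutivity on `P` applies to the fields lifted from `W` to the open set of `P` over it.
  have h : fieldToModel (VectorField.mlieBracket 𝓘(ℝ, E) (fieldOfChart x X) (fieldOfChart x Y))
      ((extChartAt 𝓘(ℝ, E) x).symm y) ∈ distribToModel L ((extChartAt 𝓘(ℝ, E) x).symm y) :=
    hL _ (fieldOfChart x X) (fieldOfChart x Y) (isOpen_extChartAt_preimage' x hW)
    (smoothFieldOn_fieldOfChart x hW hX) (smoothFieldOn_fieldOfChart x hW hY) (aux X hXL)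
    (aux Y hYL) ((extChartAt 𝓘(ℝ, E) x).symm y) ⟨hys, by rwa [mem_preimage, hyr]⟩
  rw [mlieBracket_fieldOfChart hys (by rw [hyr]; exact hX.contDiffAt (hW.mem_nhds hy))
    (by rw [hyr]; exact hY.contDiffAt (hW.mem_nhds hy)), hyr] at h
  exact h

/-- The form on the domain of the preferred chart at `x` with a given expression in this chart. -/
def formOfChart {k : ℕ} (x : P) (ζ : E → E [⋀^Fin k]→L[ℝ] T) : DiffForm E P T k :=
  fun p => show E [⋀^Fin k]→L[ℝ] T from
    (ζ (extChartAt 𝓘(ℝ, E) x p)).compContinuousLinearMap (chartDeriv x p)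

theorem inChart_formOfChart {k : ℕ} (x : P) {x' : P} (ζ : E → E [⋀^Fin k]→L[ℝ] T) {y : E}
    (hy : y ∈ (extChartAt 𝓘(ℝ, E) x').target)
    (hy' : (extChartAt 𝓘(ℝ, E) x').symm y ∈ (extChartAt 𝓘(ℝ, E) x).source) :
    (formOfChart x ζ).inChart x' y =
      pullbackForm (extChartAt 𝓘(ℝ, E) x ∘ (extChartAt 𝓘(ℝ, E) x').symm) ζ y := by
  rw [pullbackForm_transition hy hy']
  rfl

theorem inChart_formOfChart_self {k : ℕ} (x : P) (ζ : E → E [⋀^Fin k]→L[ℝ] T) {y : E}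
    (hy : y ∈ (extChartAt 𝓘(ℝ, E) x).target) : (formOfChart x ζ).inChart x y = ζ y := by
  have hys := (extChartAt 𝓘(ℝ, E) x).map_target hy
  rw [inChart_formOfChart x ζ hy hys, pullbackForm_transition hy hys,
    (extChartAt 𝓘(ℝ, E) x).right_inv hy]
  ext v
  exact congrArg (ζ y) (funext fun i => DFunLike.congr_fun (chartDeriv_comp_chartSymmDeriv hy) (v i))

theorem smoothOn_formOfChart [FiniteDimensional ℝ E] [FiniteDimensional ℝ T] {k : ℕ} (x : P)
    {ζ : E → E [⋀^Fin k]→L[ℝ] T} {U : Set E} (hU : IsOpen U) (hζ : ContDiffOn ℝ ∞ ζ U) :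
    (formOfChart x ζ).SmoothOn ((extChartAt 𝓘(ℝ, E) x).source ∩ extChartAt 𝓘(ℝ, E) x ⁻¹' U) := by
  intro x'
  have ho : IsOpen ((extChartAt 𝓘(ℝ, E) x').target ∩ (extChartAt 𝓘(ℝ, E) x').symm ⁻¹'
      ((extChartAt 𝓘(ℝ, E) x).source ∩ extChartAt 𝓘(ℝ, E) x ⁻¹' U)) :=
    (contMDiffOn_extChartAt_symm (I := 𝓘(ℝ, E)) (n := ∞) x').continuousOn.isOpen_inter_preimage
      (isOpen_extChartAt_target x') (isOpen_extChartAt_preimage' x hU)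
  -- Smoothness is required in every chart `x'`, where the form is the pullback of `ζ` under a
  -- transition map.
  refine (contDiffOn_pullbackForm ho hζ
    (fun y hy => (contDiffAt_transition hy.1 hy.2.1).contDiffWithinAt)
    fun y hy => hy.2.2).congr fun y hy => inChart_formOfChart x ζ hy.1 hy.2.1

theorem d_formOfChart {k : ℕ} {x : P} {ζ : E → E [⋀^Fin k]→L[ℝ] T} {p : P}
    (hp : p ∈ (extChartAt 𝓘(ℝ, E) x).source)
    (hζ : ContDiffAt ℝ ∞ ζ (extChartAt 𝓘(ℝ, E) x p)) :
    (formOfChart x ζ).d.toModel p =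
      (extDeriv ζ (extChartAt 𝓘(ℝ, E) x p)).compContinuousLinearMap (chartDeriv x p) := by
  have hev : (formOfChart x ζ).inChart x =ᶠ[𝓝 (extChartAt 𝓘(ℝ, E) x p)] ζ := by
    filter_upwards [(isOpen_extChartAt_target x).mem_nhds ((extChartAt 𝓘(ℝ, E) x).map_source hp)]
      with y hy using inChart_formOfChart_self x ζ hy
  rw [DiffForm.toModel_d_eq _ hp (hζ.congr_of_eventuallyEq hev), hev.extDeriv_eq]

end Transfer

end PoincareHorizontal

end

/-! ### The theorem on the manifold -/

theorem mainTheorem12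
    {E : Type*} [NormedAddCommGroup E] [NormedSpace ℝ E] [FiniteDimensional ℝ E]
    {P : Type*} [TopologicalSpace P] [ChartedSpace E P] [IsManifold 𝓘(ℝ, E) ∞ P]
    {T : Type*} [NormedAddCommGroup T] [NormedSpace ℝ T] [FiniteDimensional ℝ T]
    (L : (p : P) → Submodule ℝ (TangentSpace 𝓘(ℝ, E) p))
    (hL : PoincareHorizontal.IsDistribution L) (hinv : PoincareHorizontal.IsInvolutive L)
    (k r : ℕ) (hr : 1 ≤ r) (hrk : r ≤ k + 1)
    (η : PoincareHorizontal.DiffForm E P T (k + 1)) (hη : η.SmoothOn Set.univ)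
    (hclosed : ∀ p : P, η.d p = 0)
    (hhor : ∀ p : P, PoincareHorizontal.ContractionsVanish (L p) (r + 1) (k + 1)
      (η p).toAlternatingMap)
    (p₀ : P) :
    ∃ U : Set P, IsOpen U ∧ p₀ ∈ U ∧
      ∃ θ : PoincareHorizontal.DiffForm E P T k, θ.SmoothOn U ∧
        (∀ p ∈ U, PoincareHorizontal.ContractionsVanish (L p) r k (θ p).toAlternatingMap) ∧
        ∀ p ∈ U, η p = θ.d p := by
  have hopen := isOpen_extChartAt_target (I := 𝓘(ℝ, E)) p₀
  have hp₀s := mem_extChartAt_source (I := 𝓘(ℝ, E)) p₀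
  have hp₀t := mem_extChartAt_target (I := 𝓘(ℝ, E)) p₀
  obtain ⟨U₀, hU₀, hpU₀, d, X, hX, hXL⟩ := hL p₀
  have hV : IsOpen ((extChartAt 𝓘(ℝ, E) p₀).target ∩ (extChartAt 𝓘(ℝ, E) p₀).symm ⁻¹' U₀) :=
    (contMDiffOn_extChartAt_symm (I := 𝓘(ℝ, E)) (n := ∞) p₀).continuousOn.isOpen_inter_preimage
      hopen hU₀
  have hηc : ContDiffOn ℝ ∞ (η.inChart p₀) (extChartAt 𝓘(ℝ, E) p₀).target := by
    have h := hη p₀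
    rwa [Set.preimage_univ, Set.inter_univ] at h
  -- The flat theorem is applied in the chart at `p₀`, on the part of its target over the domain of
  -- the frame.
  obtain ⟨U, ζ, hU, hyU, hUV, hζ, hζhor, hζd⟩ :=
    PoincareHorizontal.exists_horizontal_primitive hV
      (y₀ := extChartAt 𝓘(ℝ, E) p₀ p₀) ⟨hp₀t, by rwa [Set.mem_preimage, extChartAt_to_inv]⟩
      (L := PoincareHorizontal.distribInChart p₀ L)
      (fun i => PoincareHorizontal.contDiffOn_fieldInChart p₀ hU₀ (hX i))
      (fun y hy => PoincareHorizontal.frame_fieldInChart hy.1 (hXL _ hy.2))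
      (fun W hWV hW Y Z hY hZ hYL hZL y hy =>
        hinv.distribInChart p₀ (hWV.trans Set.inter_subset_left) hW hY hZ hYL hZL hy)
      (hηc.mono Set.inter_subset_left)
      (fun y hy => PoincareHorizontal.DiffForm.extDeriv_inChart_eq_zero hη hclosed p₀ hy.1) hr
      (fun y hy => PoincareHorizontal.ContractionsVanish.comp
        (V := PoincareHorizontal.distribToModel L ((extChartAt 𝓘(ℝ, E) p₀).symm y))
        (α := η.toModel ((extChartAt 𝓘(ℝ, E) p₀).symm y)) (hhor _)
        (PoincareHorizontal.chartSymmDeriv p₀ y) fun v hv => hv)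
  refine ⟨(extChartAt 𝓘(ℝ, E) p₀).source ∩ extChartAt 𝓘(ℝ, E) p₀ ⁻¹' U,
    isOpen_extChartAt_preimage' p₀ hU, ⟨hp₀s, hyU⟩, PoincareHorizontal.formOfChart p₀ ζ,
    PoincareHorizontal.smoothOn_formOfChart p₀ hU hζ, ?_, ?_⟩
  · rintro p ⟨hp, hpU⟩
    exact (hζhor _ hpU).comp (V' := PoincareHorizontal.distribToModel L p)
      (PoincareHorizontal.chartDeriv p₀ p)
      fun v hv => PoincareHorizontal.chartDeriv_mem_distribInChart hp hv
  · rintro p ⟨hp, hpU⟩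
    have h := PoincareHorizontal.d_formOfChart hp (hζ.contDiffAt (hU.mem_nhds hpU))
    rw [hζd _ hpU, ← η.toModel_eq_inChart hp] at h
    exact h.symm
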